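/- **Setting.** Let $\Omega\subset\mathbb R^2$ be a non-empty bounded open set with $C^1$ boundary, $\partial\Omega=\Gamma^N\cup\Gamma^R$ with $\Gamma^N,\Gamma^R$ disjoint, measurable and of positive one-dimensional Hausdorff measure $\gamma$; let $T>0$, $S=(0,T)$. Let $g(s)=a_0s^{\alpha_0}+\dots+a_Ns^{\alpha_N}$ for $s\ge 0$ with exponents $\alpha_k\ge 0$, coefficients $a_k\ge 0$, $a_0>0$ and $g(0)>0$, and put $K_1(\xi)=1/g(s(\xi))$ for $\xi\ge0$, where $s=s(\xi)\ge 0$ is the unique non-negative solution of $s\,g(s)=\xi$. Let $a=\frac{\alpha_N}{\alpha_N+1}\in(0,1)$, $2\le\alpha\le2$ (so $\alpha=2$; this is $2-\delta\le\alpha\le 2$ with $\lambda=1$, $\delta=1-\lambda=0$), $\sigma\in(0,1)$, $\sigma\le\alpha/2$, $K_2>0$, $u_0\in L^\alpha(\Omega)$, $v_0\in L^2(\Omega)$. Assume: * (A1) $K_1$ is decreasing with $0<K_1\le 1/a_0$ on $[0,\infty)$, and there are $d_1,d_2,d_3>0$ such that for all $\xi\ge0$: $\frac{d_1}{(1+\xi)^a}\le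 K_1(\xi)\le\frac{d_2}{(1+\xi)^a}$ and $d_3(\xi^{2-a}-1)\le K_1(\xi)\xi^2\le d_2\xi^{2-a}$; * (A2) $b:\mathbb R\to\mathbb R$ satisfies $b(z)\le\hat c|z|^\sigma$ for all $z$, for some $\hat c>0$; * (A3) $b$ is globally Lipschitz continuous; * (A4) $\varphi\in L^\infty(\Gamma^R)$ and $\varphi\ge0$ a.e. on $\Gamma^R$. Consider, for scalar functions $u,v$ on $S\times\Omega$, the system $$\partial_t u-\operatorname{div}(K_1(|\nabla u|)\nabla u)=-b(u-v),\qquad \partial_t v-K_2\Delta v=b(u-v)\quad\text{in }S\times\Omega,$$ $$-K_1(|\nabla u|)\nabla u\cdot\mathbf n=\varphi u\ \text{ on }S\times\Gamma^R,\qquad -K_1(|\nabla u|)\nabla u\cdot\mathbf n=0\ \text{ on }S\times\Gamma^N,\qquad -K_2\nabla v\cdot\mathbf n=0\ \text{ on }S\times\partial\Omega,$$ $$u(0,\cdot)=u_0,\qquad v(0,\cdot)=v_0 .$$ **Weak solutions.** A weak solution is a pair $$(u,v)\in\big(L^\alpha(S;L^\alpha(\Omega))\cap L^{2-a}(S;W^{1,2-a}(\Omega))\big)\times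 L^2(S;W^{1,2}(\Omega))$$ such that for all $\psi\in L^\alpha(\Omega)\cap W^{1,2-a}(\Omega)$ and $\phi\in W^{1,2}(\Omega)$ the product of $\varphi$ and the traces of $u$ and $\psi$ is integrable on $S\times\Gamma^R$, and for a.e. $t\in S$ $$\int_\Omega\partial_tu\,\psi\,dx+\int_\Omega K_1(|\nabla u|)\nabla u\cdot\nabla\psi\,dx+\int_{\Gamma^R}\varphi u\psi\,d\gamma=-\int_\Omega b(u-v)\psi\,dx,$$ $$\int_\Omega\partial_tv\,\phi\,dx+\int_\Omega K_2\nabla v\cdot\nabla\phi\,dx=\int_\Omega b(u-v)\phi\,dx,$$ with initial data $(u_0,v_0)$. Here $\int_\Omega\partial_tu\,\psi\,dx$ denotes the weak derivative in $L^1(S)$ of $t\mapsto\int_\Omega u(t)\psi\,dx$, and the initial condition means that the absolutely continuous representative of this function has the value $\int_\Omega u_0\psi\,dx$ at $t=0$; likewise for $v$. **Theorem.** Under these assumptions the system has at most one weak solution: if $(u_1,v_1)$ and $(u_2,v_2)$ are weak solutions with the same data, then $u_1=u_2$ and $v_1=v_2$ a.e. in $S\times\Omega$. -/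

import Mathlib

open MeasureTheory Set Filter Topology
open scoped ENNReal ContDiff

noncomputable section

namespace ForchheimerUniqueness

/-- The Euclidean plane `ℝ²`. -/
abbrev Plane : Type := EuclideanSpace ℝ (Fin 2)

/-- The one-dimensional surface measure (arc length) on a subset `Γ` of the plane. -/
def arcLength (Γ : Set Plane) : Measure Plane := (Measure.hausdorffMeasure 1).restrict Γ

/-- Lebesgue measure on the time interval `S = (0, T)`. -/
def timeMeasure (T : ℝ) : Measure ℝ := volume.restrict (Ioo 0 T)

/-- Lebesgue measure on the space-time cylinder `S × Ω`. -/
def cylMeasure (T : ℝ) (Ω : Set Plane) : Measure (ℝ × Plane) :=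
  (timeMeasure T).prod (volume.restrict Ω)

/-! ### The domain -/

/-- `Ω` has a `C¹` boundary: near every boundary point and after an orthogonal change of
coordinates, `Ω` is the region strictly above the graph of a `C¹` function. -/
def HasC1Boundary (Ω : Set Plane) : Prop :=
  ∀ x₀ ∈ frontier Ω, ∃ (r : ℝ) (e : Plane ≃ₗᵢ[ℝ] Plane) (h : ℝ → ℝ),
    0 < r ∧ ContDiff ℝ 1 h ∧
      Ω ∩ Metric.ball x₀ r = {x | x ∈ Metric.ball x₀ r ∧ h (e x 0) < e x 1}

/-- A non-empty bounded open set in the plane with `C¹` boundary, whose boundary is the disjoint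
union of two (measurable) parts `ΓN`, `ΓR`, both of positive surface measure. -/
structure IsC1Domain (Ω ΓN ΓR : Set Plane) : Prop where
  isOpen : IsOpen Ω
  nonempty : Ω.Nonempty
  isBounded : Bornology.IsBounded Ω
  c1Boundary : HasC1Boundary Ω
  measurableSet_N : MeasurableSet ΓN
  measurableSet_R : MeasurableSet ΓR
  union_eq : ΓN ∪ ΓR = frontier Ω
  disjoint : Disjoint ΓN ΓR
  pos_N : 0 < Measure.hausdorffMeasure (X := Plane) 1 ΓN
  pos_R : 0 < Measure.hausdorffMeasure (X := Plane) 1 ΓR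

/-! ### The nonlinearity `K₁` -/

/-- The generalized polynomial `g(s) = a₀ s^{α₀} + ⋯ + a_N s^{α_N}`. -/
def genPoly {N : ℕ} (coef expo : Fin (N + 1) → ℝ) (s : ℝ) : ℝ :=
  ∑ k, coef k * s ^ expo k

/-- `K₁(ξ) = 1 / g(s(ξ))`, where `s = s(ξ) ≥ 0` is the non-negative solution of `s g(s) = ξ`
(existing and unique for `ξ ≥ 0` if `g` is a generalized polynomial with non-negative
coefficients and exponents and `g(0) > 0`). -/
def darcyK1 (g : ℝ → ℝ) (ξ : ℝ) : ℝ :=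
  1 / g (Function.invFunOn (fun s : ℝ => s * g s) (Ici 0) ξ)

/-- The structural assumption on `K = K₁`, with exponent `a` and upper bound `1 / a₀`. -/
structure K1Structure (K : ℝ → ℝ) (a a₀ : ℝ) : Prop where
  pos : ∀ ξ, 0 ≤ ξ → 0 < K ξ
  le_inv : ∀ ξ, 0 ≤ ξ → K ξ ≤ 1 / a₀
  antitone : AntitoneOn K (Ici 0)
  bounds : ∃ d₁ d₂ d₃ : ℝ, 0 < d₁ ∧ 0 < d₂ ∧ 0 < d₃ ∧ ∀ ξ, 0 ≤ ξ →
    d₁ / (1 + ξ) ^ a ≤ K ξ ∧ K ξ ≤ d₂ / (1 + ξ) ^ a ∧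
    d₃ * (ξ ^ (2 - a) - 1) ≤ K ξ * ξ ^ 2 ∧ K ξ * ξ ^ 2 ≤ d₂ * ξ ^ (2 - a)

/-! ### Sobolev functions and traces -/

/-- `f ∈ W^{1,p}(Ω)` with weak gradient `G`. -/
structure IsSobolev (Ω : Set Plane) (p : ℝ≥0∞) (f : Plane → ℝ) (G : Plane → Plane) : Prop where
  memLp : MemLp f p (volume.restrict Ω)
  memLp_grad : MemLp G p (volume.restrict Ω)
  weak_grad : ∀ η : Plane → ℝ, ContDiff ℝ ∞ η → HasCompactSupport η → tsupport η ⊆ Ω →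
    ∀ e : Plane, ∫ x in Ω, f x * fderiv ℝ η x e = - ∫ x in Ω, inner ℝ (G x) e * η x

/-- `h ∈ L^p(∂Ω)` is the boundary trace of the `W^{1,p}(Ω)` function `f` with weak gradient `G`:
`f` is the `W^{1,p}(Ω)`-limit of functions smooth up to the boundary whose boundary values
converge to `h` in `L^p(∂Ω)`. -/
def IsTrace (Ω : Set Plane) (p : ℝ≥0∞) (f : Plane → ℝ) (G : Plane → Plane)
    (h : Plane → ℝ) : Prop :=
  MemLp h p (arcLength (frontier Ω)) ∧
  ∃ ζ : ℕ → Plane → ℝ, (∀ n, ContDiff ℝ ∞ (ζ n)) ∧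
    Tendsto (fun n => eLpNorm (fun x => ζ n x - f x) p (volume.restrict Ω)) atTop (𝓝 0) ∧
    Tendsto (fun n => eLpNorm (fun x => gradient (ζ n) x - G x) p (volume.restrict Ω))
      atTop (𝓝 0) ∧
    Tendsto (fun n => eLpNorm (fun x => ζ n x - h x) p (arcLength (frontier Ω))) atTop (𝓝 0)

/-- `u ∈ L^p(S; W^{1,p}(Ω))` with spatial weak gradient `G`, as functions on `S × Ω`. -/
structure IsParabolicSobolev (T : ℝ) (Ω : Set Plane) (p : ℝ≥0∞)
    (u : ℝ → Plane → ℝ) (G : ℝ → Plane → Plane) : Prop where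
  memLp : MemLp (fun q : ℝ × Plane => u q.1 q.2) p (cylMeasure T Ω)
  memLp_grad : MemLp (fun q : ℝ × Plane => G q.1 q.2) p (cylMeasure T Ω)
  sobolev : ∀ᵐ t ∂(timeMeasure T), IsSobolev Ω p (u t) (G t)

/-- `τ ∈ L^p(S; L^p(∂Ω))` is the boundary trace of `u ∈ L^p(S; W^{1,p}(Ω))`. -/
structure IsParabolicTrace (T : ℝ) (Ω : Set Plane) (p : ℝ≥0∞)
    (u : ℝ → Plane → ℝ) (G : ℝ → Plane → Plane) (τ : ℝ → Plane → ℝ) : Prop where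
  memLp : MemLp (fun q : ℝ × Plane => τ q.1 q.2) p
    ((timeMeasure T).prod (arcLength (frontier Ω)))
  trace : ∀ᵐ t ∂(timeMeasure T), IsTrace Ω p (u t) (G t) (τ t)

/-! ### Weak solutions -/

/-- The scalar function `m` on `(0, T)` (defined almost everywhere) has the initial value `m₀` and
the integrable weak derivative `f`, i.e. it agrees a.e. with an absolutely continuous function on
`[0, T]` that starts at `m₀` and has derivative `f` a.e. -/
def HasTimeDerivative (T : ℝ) (m : ℝ → ℝ) (m₀ : ℝ) (f : ℝ → ℝ) : Prop :=
  IntegrableOn f (Ioo 0 T) ∧ ∀ᵐ t ∂(timeMeasure T), m t = m₀ + ∫ s in (0 : ℝ)..t, f s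

/-- `(u, v)` is a weak solution on `(0, T) × Ω`, with data `K` (for `K₁`), `K₂`, `b`, `φ` and
initial values `u₀`, `v₀`, of
`∂ₜu - div(K(|∇u|)∇u) = -b(u - v)`, `∂ₜv - K₂ Δv = b(u - v)`,
`-K(|∇u|)∇u · n = φ u` on `ΓR`, `-K(|∇u|)∇u · n = 0` on `∂Ω \ ΓR`, `-K₂∇v · n = 0` on `∂Ω`.
Here `Gu`, `Gv` are the spatial gradients of `u`, `v` and `τ` is the trace of `u`.  The term
`∫_Ω ∂ₜu ψ dx` is the weak time derivative of `t ↦ ∫_Ω u(t) ψ dx`, and likewise for `v`. -/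
def IsWeakSolution (T : ℝ) (Ω ΓR : Set Plane) (α a : ℝ) (K : ℝ → ℝ) (K₂ : ℝ) (b : ℝ → ℝ)
    (φ : Plane → ℝ) (u₀ v₀ : Plane → ℝ) (u v : ℝ → Plane → ℝ) : Prop :=
  MemLp (fun q : ℝ × Plane => u q.1 q.2) (ENNReal.ofReal α) (cylMeasure T Ω) ∧
  ∃ (Gu Gv : ℝ → Plane → Plane) (τ : ℝ → Plane → ℝ),
    IsParabolicSobolev T Ω (ENNReal.ofReal (2 - a)) u Gu ∧
    IsParabolicSobolev T Ω 2 v Gv ∧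
    IsParabolicTrace T Ω (ENNReal.ofReal (2 - a)) u Gu τ ∧
    (∀ (ψ : Plane → ℝ) (Gψ : Plane → Plane) (h : Plane → ℝ),
      MemLp ψ (ENNReal.ofReal α) (volume.restrict Ω) →
      IsSobolev Ω (ENNReal.ofReal (2 - a)) ψ Gψ →
      IsTrace Ω (ENNReal.ofReal (2 - a)) ψ Gψ h →
      Integrable (fun q : ℝ × Plane => φ q.2 * τ q.1 q.2 * h q.2)
        ((timeMeasure T).prod (arcLength ΓR)) ∧
      HasTimeDerivative T (fun t => ∫ x in Ω, u t x * ψ x) (∫ x in Ω, u₀ x * ψ x)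
        (fun t => - (∫ x in Ω, K ‖Gu t x‖ * inner ℝ (Gu t x) (Gψ x))
          - (∫ x, φ x * τ t x * h x ∂(arcLength ΓR))
          - ∫ x in Ω, b (u t x - v t x) * ψ x)) ∧
    (∀ (χ : Plane → ℝ) (Gχ : Plane → Plane),
      IsSobolev Ω 2 χ Gχ →
      HasTimeDerivative T (fun t => ∫ x in Ω, v t x * χ x) (∫ x in Ω, v₀ x * χ x)
        (fun t => - (∫ x in Ω, K₂ * inner ℝ (Gv t x) (Gχ x))
          + ∫ x in Ω, b (u t x - v t x) * χ x))

end ForchheimerUniqueness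

end

noncomputable section

namespace ForchheimerUniqueness

/-! ### An integral Gronwall lemma -/

/-! The proof is an energy argument for the differences w = u₁ − u₂ and z = v₁ − v₂. Testing the
equations with w and z, the flux term has a sign because x ↦ K₁(|x|)x is monotone, the boundary term
has a sign because φ ≥ 0, and the Lipschitz coupling is bounded by the energy ½∫w² + ½∫z². Gronwall
(`ae_eq_zero_of_le_mul_integral`) then gives w = z = 0. Monotonicity rests on K₁(ξ)ξ = s(ξ), the
inverse of the increasing function s·g(s) (`monotoneOn_darcyK1_mul`,
`inner_sub_nonneg_of_monotoneOn`).

Two points make the formal testing delicate. First, the trace of w is only known to lie in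
L^{2−a}(∂Ω), so the boundary term need not pair with w itself. The test function is therefore θ(w)
with θ = `trunc ε` smooth, bounded and with 0 ≤ θ' ≤ 1. Its trace is bounded, hence in the dual
exponent, since the boundary has finite length (`hausdorffMeasure_frontier_lt_top`); a chain rule
with traces (`IsTrace.trunc_comp`) makes θ(w) admissible. The energy density becomes the convex
primitive Θ of θ, and ε → 0 recovers w²/2. The linear equation for z has no boundary term and is
tested with z directly.

Second, w has only a weak time derivative, and each test function comes with its own exceptional
null set of times. Separability of L^p yields one null set for all tests (`ae_forall_test`), so at
time t the test θ(w(t)) may be inserted. The chain rule in time is replaced by convexity: Θ(w(t)) −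
Θ(w(t−h)) ≤ (w(t) − w(t−h))θ(w(t)), and the right side, integrated over Ω, is the time integral over
(t−h, t) of the equation's functionals applied to the test at time t. Integrating in t and dividing
by h, the left side converges at Lebesgue points and the right side by continuity of translations in
L^p (`tendsto_average_triplePairing`). The result is `integral_truncPrim_le`, the abstract energy
inequality applied to both components. -/

/-- Since y is merely integrable, the differential Gronwall inequality is applied one integration
higher. The primitive Y of y is continuous, its primitive Z is differentiable everywhere, and
integrating the hypothesis gives Z' = Y ≤ C·Z with Z(0) = 0. -/
lemma ae_eq_zero_of_le_mul_integral {T C : ℝ} (hC : 0 ≤ C) {y : ℝ → ℝ}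
    (hy : IntegrableOn y (Ioo 0 T)) (h0 : ∀ᵐ t ∂(timeMeasure T), 0 ≤ y t)
    (h : ∀ᵐ t ∂(timeMeasure T), y t ≤ C * ∫ s in (0 : ℝ)..t, y s) :
    ∀ᵐ t ∂(timeMeasure T), y t = 0 := by
  set z : ℝ → ℝ := (Ioo 0 T).indicator y with hz
  have hzi : Integrable z := hy.integrable_indicator measurableSet_Ioo
  have hz0 : ∀ᵐ t, 0 ≤ z t := by
    filter_upwards [(ae_restrict_iff' measurableSet_Ioo).1 h0] with t ht
    by_cases hm : t ∈ Ioo 0 T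
    · simpa [hz, hm] using ht hm
    · simp [hz, hm]
  set Y : ℝ → ℝ := fun t => ∫ s in (0 : ℝ)..t, z s with hY
  have hYc : Continuous Y := intervalIntegral.continuous_primitive
    (fun _ _ => hzi.intervalIntegrable) 0
  have hYz : ∀ t ∈ Ioo 0 T, ∫ s in (0 : ℝ)..t, y s = Y t := by
    intro t ht
    refine intervalIntegral.integral_congr_ae (ae_of_all _ fun s hs => ?_)
    rw [uIoc_of_le ht.1.le] at hs
    have : s ∈ Ioo 0 T := ⟨hs.1, hs.2.trans_lt ht.2⟩
    simp [hz, this]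
  have hzle : ∀ᵐ t, t ∈ Ioo 0 T → z t ≤ C * Y t := by
    filter_upwards [(ae_restrict_iff' measurableSet_Ioo).1 h] with t ht hm
    rw [← hYz t hm]
    simpa [hz, hm] using ht hm
  have hY0 : ∀ t, 0 ≤ t → 0 ≤ Y t := fun t ht =>
    intervalIntegral.integral_nonneg_of_ae ht hz0
  set Z : ℝ → ℝ := fun t => ∫ s in (0 : ℝ)..t, Y s with hZ
  have hZd : ∀ t, HasDerivAt Z (Y t) t := fun t =>
    intervalIntegral.integral_hasDerivAt_right (hYc.intervalIntegrable _ _)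
      (hYc.stronglyMeasurableAtFilter _ _) hYc.continuousAt
  have hYZ : ∀ t ∈ Ico 0 T, Y t ≤ C * Z t := by
    intro t ht
    rw [hZ, hY]
    simp only
    rw [← intervalIntegral.integral_const_mul]
    refine intervalIntegral.integral_mono_ae_restrict ht.1 hzi.intervalIntegrable
      ((hYc.const_mul C).intervalIntegrable _ _) ?_
    filter_upwards [ae_restrict_of_ae hzle, ae_restrict_of_ae (Measure.ae_ne volume 0),
      ae_restrict_mem measurableSet_Icc] with s hs hs0 hm
    exact hs ⟨lt_of_le_of_ne hm.1 hs0.symm, hm.2.trans_lt ht.2⟩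
  have hZ0 : ∀ t ∈ Icc 0 T, ‖Z t‖ ≤ gronwallBound 0 C 0 (t - 0) := by
    refine norm_le_gronwallBound_of_norm_deriv_right_le (f' := Y)
      (fun t _ => (hZd t).continuousAt.continuousWithinAt)
      (fun t _ => (hZd t).hasDerivWithinAt) (by simp [hZ]) ?_
    intro t ht
    rw [add_zero, Real.norm_of_nonneg (hY0 t ht.1)]
    exact (hYZ t ht).trans (mul_le_mul_of_nonneg_left (le_abs_self _) hC)
  have hYzero : ∀ t ∈ Ico 0 T, Y t ≤ 0 := by
    intro t ht
    have := hZ0 t ⟨ht.1, ht.2.le⟩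
    simp only [gronwallBound_ε0_δ0, norm_le_zero_iff] at this
    simpa [this] using hYZ t ht
  filter_upwards [h0, h, ae_restrict_mem measurableSet_Ioo] with t h1 h2 h3
  rw [hYz t h3] at h2
  exact le_antisymm (h2.trans (mul_nonpos_of_nonneg_of_nonpos hC (hYzero t ⟨h3.1.le, h3.2⟩))) h1

/-! ### The nonlinearity -/

section Nonlinearity

variable {N : ℕ} {coef expo : Fin (N + 1) → ℝ}

lemma monotoneOn_genPoly (hcoef : ∀ k, 0 ≤ coef k) (hexpo : ∀ k, 0 ≤ expo k) :
    MonotoneOn (genPoly coef expo) (Ici 0) := fun _ hs _ _ hst =>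
  Finset.sum_le_sum fun k _ =>
    mul_le_mul_of_nonneg_left (Real.rpow_le_rpow hs hst (hexpo k)) (hcoef k)

lemma continuous_genPoly (hexpo : ∀ k, 0 ≤ expo k) : Continuous (genPoly coef expo) :=
  continuous_finsetSum _ fun k _ =>
    continuous_const.mul (Real.continuous_rpow_const (hexpo k))

/-- `ξ ↦ K₁(ξ) ξ` is monotone. -/
lemma monotoneOn_darcyK1_mul {g : ℝ → ℝ} (hg : MonotoneOn g (Ici 0)) (hc : Continuous g)
    (h0 : 0 < g 0) : MonotoneOn (fun ξ => darcyK1 g ξ * ξ) (Ici 0) := by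
  have hpos : ∀ s, 0 ≤ s → 0 < g s := fun s hs => h0.trans_le (hg self_mem_Ici hs hs)
  have hex : ∀ ξ, 0 ≤ ξ → ∃ s ∈ Ici (0 : ℝ), s * g s = ξ := by
    intro ξ hξ
    -- The right endpoint ξ / g(0) works because g ≥ g(0) there, so s·g(s) ≥ ξ.
    have hle : (0 : ℝ) ≤ ξ / g 0 := by positivity
    have := intermediate_value_Icc (f := fun s => s * g s) hle (by fun_prop)
    obtain ⟨s, hs, h⟩ := this (show ξ ∈ _ by
      refine ⟨by simpa, ?_⟩
      have h1 := hg self_mem_Ici hle hle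
      calc ξ = ξ / g 0 * g 0 := by field_simp
        _ ≤ _ := mul_le_mul_of_nonneg_left h1 hle)
    exact ⟨s, hs.1, h⟩
  intro ξ hξ η hη hle
  have e1 := Function.invFunOn_eq (hex ξ hξ)
  have m1 := Function.invFunOn_mem (hex ξ hξ)
  have e2 := Function.invFunOn_eq (hex η hη)
  have m2 := Function.invFunOn_mem (hex η hη)
  simp only [darcyK1]
  set s := Function.invFunOn (fun s : ℝ => s * g s) (Ici 0) ξ
  set t := Function.invFunOn (fun s : ℝ => s * g s) (Ici 0) η
  have p1 := hpos s m1
  have p2 := hpos t m2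
  -- K₁(ξ)ξ is s(ξ) itself, so the claim becomes monotonicity of the inverse of s·g(s).
  have q1 : 1 / g s * ξ = s := by rw [← e1]; field_simp
  have q2 : 1 / g t * η = t := by rw [← e2]; field_simp
  rw [q1, q2]
  by_contra! hlt
  have h1 : g t ≤ g s := hg m2 m1 hlt.le
  have h2 : t * g t < s * g s :=
    (mul_lt_mul_of_pos_right hlt p2).trans_le (mul_le_mul_of_nonneg_left h1 m1)
  linarith

end Nonlinearity

/-- If `ξ ↦ K(ξ) ξ` is monotone, then so is the vector field `x ↦ K(|x|) x`. -/
lemma inner_sub_nonneg_of_monotoneOn {E : Type*} [NormedAddCommGroup E] [InnerProductSpace ℝ E]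
    {K : ℝ → ℝ} (hK : ∀ ξ, 0 ≤ ξ → 0 ≤ K ξ) (hm : MonotoneOn (fun ξ => K ξ * ξ) (Ici 0))
    (x y : E) : 0 ≤ inner ℝ (K ‖x‖ • x - K ‖y‖ • y) (x - y) := by
  have h1 : inner ℝ (K ‖x‖ • x - K ‖y‖ • y) (x - y)
      = K ‖x‖ * ‖x‖ ^ 2 + K ‖y‖ * ‖y‖ ^ 2 - (K ‖x‖ + K ‖y‖) * inner ℝ x y := by
    simp only [inner_sub_left, inner_sub_right, real_inner_smul_left, real_inner_self_eq_norm_sq,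
      real_inner_comm x y]
    ring
  -- After Cauchy–Schwarz on the mixed term, the expression in `h1` is bounded below by exactly this
  -- radial product.
  have h2 : 0 ≤ (K ‖x‖ * ‖x‖ - K ‖y‖ * ‖y‖) * (‖x‖ - ‖y‖) := by
    rcases le_total ‖x‖ ‖y‖ with h | h
    · have := hm (norm_nonneg x) (norm_nonneg y) h
      simp only at this
      nlinarith
    · have := hm (norm_nonneg y) (norm_nonneg x) h
      simp only at this
      nlinarith
  have h3 := mul_le_mul_of_nonneg_left (real_inner_le_norm x y)
    (add_nonneg (hK _ (norm_nonneg x)) (hK _ (norm_nonneg y)))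
  rw [h1]
  nlinarith

/-! ### A smooth bounded truncation -/

/-- The truncation `s / √(1 + ε s²)`. -/
def trunc (ε s : ℝ) : ℝ := s / √(1 + ε * s ^ 2)

/-- The primitive `s² / (1 + √(1 + ε s²))` of `trunc ε`. -/
def truncPrim (ε s : ℝ) : ℝ := s ^ 2 / (1 + √(1 + ε * s ^ 2))

section Trunc

variable {ε : ℝ}

lemma one_le_sqrt_aux (hε : 0 ≤ ε) (s : ℝ) : 1 ≤ √(1 + ε * s ^ 2) := by
  rw [Real.one_le_sqrt]
  nlinarith [mul_nonneg hε (sq_nonneg s)]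

lemma contDiff_trunc (hε : 0 ≤ ε) : ContDiff ℝ ∞ (trunc ε) := by
  have h : ∀ s : ℝ, 1 + ε * s ^ 2 ≠ 0 := fun s => by positivity
  refine contDiff_id.div (ContDiff.sqrt (by fun_prop) h) fun s => ?_
  have := one_le_sqrt_aux hε s
  positivity

lemma hasDerivAt_trunc (hε : 0 ≤ ε) (s : ℝ) :
    HasDerivAt (trunc ε) (1 / √(1 + ε * s ^ 2) ^ 3) s := by
  have h1 := one_le_sqrt_aux hε s
  have h0 : 1 + ε * s ^ 2 ≠ 0 := by positivity
  have hd : HasDerivAt (fun s : ℝ => 1 + ε * s ^ 2) (ε * (2 * s)) s := by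
    simpa using ((hasDerivAt_pow 2 s).const_mul ε).const_add 1
  have hs : √(1 + ε * s ^ 2) ^ 2 = 1 + ε * s ^ 2 := Real.sq_sqrt (by positivity)
  have heq : 1 / √(1 + ε * s ^ 2) ^ 3 = (1 * √(1 + ε * s ^ 2) -
      id s * (ε * (2 * s) / (2 * √(1 + ε * s ^ 2)))) / √(1 + ε * s ^ 2) ^ 2 := by
    set r := √(1 + ε * s ^ 2)
    have hr : r ≠ 0 := by positivity
    rw [id]
    field_simp
    linarith
  rw [heq]
  exact (hasDerivAt_id s).div (hd.sqrt h0) (by positivity)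

/-- This sign preserves the monotonicity of the flux term once the gradient of θ(w) is expanded as
θ'(w)∇w. -/
lemma deriv_trunc_nonneg (hε : 0 ≤ ε) (s : ℝ) : 0 ≤ deriv (trunc ε) s := by
  rw [(hasDerivAt_trunc hε s).deriv]
  positivity

lemma deriv_trunc_le_one (hε : 0 ≤ ε) (s : ℝ) : deriv (trunc ε) s ≤ 1 := by
  rw [(hasDerivAt_trunc hε s).deriv]
  have := one_le_sqrt_aux hε s
  rw [div_le_one (by positivity)]
  exact one_le_pow₀ this

lemma lipschitzWith_trunc (hε : 0 ≤ ε) : LipschitzWith 1 (trunc ε) := by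
  refine lipschitzWith_of_nnnorm_deriv_le
    (fun s => (hasDerivAt_trunc hε s).differentiableAt) fun s => ?_
  rw [← NNReal.coe_le_coe, coe_nnnorm, Real.norm_of_nonneg (deriv_trunc_nonneg hε s)]
  exact deriv_trunc_le_one hε s

lemma abs_trunc_le (hε : 0 ≤ ε) (s : ℝ) : |trunc ε s| ≤ |s| := by
  have := one_le_sqrt_aux hε s
  rw [trunc, abs_div, abs_of_nonneg (Real.sqrt_nonneg _)]
  exact div_le_self (abs_nonneg _) this

/-- For ε > 0 this places the truncated trace in every L^q of a finite boundary measure. -/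
lemma abs_trunc_le_const (hε : 0 < ε) (s : ℝ) : |trunc ε s| ≤ 1 / √ε := by
  have h := one_le_sqrt_aux hε.le s
  have h2 : √ε * |s| ≤ √(1 + ε * s ^ 2) := by
    rw [← Real.sqrt_sq_eq_abs, ← Real.sqrt_mul hε.le]
    exact Real.sqrt_le_sqrt (by linarith)
  have := Real.sqrt_pos.2 hε
  rw [trunc, abs_div, abs_of_nonneg (Real.sqrt_nonneg _), div_le_div_iff₀ (by linarith) this]
  linarith

lemma trunc_mul_self_nonneg (s : ℝ) : 0 ≤ s * trunc ε s := by
  rw [trunc, ← mul_div_assoc]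
  exact div_nonneg (mul_self_nonneg s) (Real.sqrt_nonneg _)

lemma truncPrim_nonneg (s : ℝ) : 0 ≤ truncPrim ε s := by
  unfold truncPrim; positivity

lemma truncPrim_le (hε : 0 ≤ ε) (s : ℝ) : truncPrim ε s ≤ s ^ 2 / 2 := by
  have := one_le_sqrt_aux hε s
  exact div_le_div_of_nonneg_left (sq_nonneg s) two_pos (by linarith)

lemma continuous_truncPrim (hε : 0 ≤ ε) : Continuous (truncPrim ε) := by
  refine Continuous.div (by fun_prop) (by fun_prop) fun s => ?_
  have := one_le_sqrt_aux hε s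
  linarith

lemma truncPrim_zero_left (s : ℝ) : truncPrim 0 s = s ^ 2 / 2 := by
  norm_num [truncPrim]

lemma trunc_zero_left (s : ℝ) : trunc 0 s = s := by simp [trunc]

lemma tendsto_truncPrim (s : ℝ) :
    Tendsto (fun ε => truncPrim ε s) (𝓝 0) (𝓝 (s ^ 2 / 2)) := by
  have : ContinuousAt (fun ε => truncPrim ε s) 0 := by
    unfold truncPrim
    refine ContinuousAt.div (by fun_prop) (by fun_prop) (by norm_num)
  simpa [ContinuousAt, truncPrim_zero_left] using this

/-- Convexity of `truncPrim ε`. -/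
lemma truncPrim_sub_le (hε : 0 ≤ ε) (s t : ℝ) :
    truncPrim ε s - truncPrim ε t ≤ (s - t) * trunc ε s := by
  rcases hε.eq_or_lt with rfl | hε'
  · rw [truncPrim_zero_left, truncPrim_zero_left, trunc_zero_left]
    nlinarith [sq_nonneg (s - t)]
  have hs := one_le_sqrt_aux hε s
  have ht := one_le_sqrt_aux hε t
  have es : √(1 + ε * s ^ 2) ^ 2 = 1 + ε * s ^ 2 := Real.sq_sqrt (by positivity)
  have et : √(1 + ε * t ^ 2) ^ 2 = 1 + ε * t ^ 2 := Real.sq_sqrt (by positivity)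
  unfold truncPrim trunc
  set A := √(1 + ε * s ^ 2)
  set B := √(1 + ε * t ^ 2)
  -- From (A − 1)(A + 1) = ε s², the primitive equals (A − 1)/ε.
  have hA : s ^ 2 / (1 + A) = (A - 1) / ε := by
    rw [div_eq_div_iff (by linarith) hε'.ne']; nlinarith
  have hB : t ^ 2 / (1 + B) = (B - 1) / ε := by
    rw [div_eq_div_iff (by linarith) hε'.ne']; nlinarith
  -- Cauchy–Schwarz for the vectors (1, √ε s) and (1, √ε t).
  have key : 1 + ε * s * t ≤ A * B := by
    refine abs_le_of_sq_le_sq' ?_ (by positivity) |>.2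
    have : (A * B) ^ 2 = (1 + ε * s ^ 2) * (1 + ε * t ^ 2) := by rw [mul_pow, es, et]
    rw [this]
    nlinarith [mul_nonneg hε (sq_nonneg (s - t))]
  rw [hA, hB, ← sub_div, ← mul_div_assoc, div_le_div_iff₀ hε' (by linarith)]
  nlinarith

end Trunc

/-! ### The boundary has finite length -/

/-- A C¹ curve is Lipschitz on a compact parameter interval, and Lipschitz maps enlarge
one-dimensional Hausdorff measure by at most a constant factor. -/
lemma hausdorffMeasure_graph_lt_top {h : ℝ → ℝ} (hh : ContDiff ℝ 1 h) (e : Plane ≃ₗᵢ[ℝ] Plane)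
    (R : ℝ) :
    Measure.hausdorffMeasure 1 {x : Plane | e x 1 = h (e x 0) ∧ |e x 0| ≤ R} < ⊤ := by
  have hγ : ContDiff ℝ 1 (fun t : ℝ => e.symm (!₂[t, h t])) := by
    refine e.symm.contDiff.comp ?_
    rw [contDiff_euclidean]
    intro i
    fin_cases i
    · exact contDiff_id
    · exact hh
  obtain ⟨C, hC⟩ := hγ.locallyLipschitz.locallyLipschitzOn.exists_lipschitzOnWith_of_compact
    (isCompact_Icc (a := -R) (b := R))
  have hsub : {x : Plane | e x 1 = h (e x 0) ∧ |e x 0| ≤ R} ⊆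
      (fun t : ℝ => e.symm (!₂[t, h t])) '' Icc (-R) R := by
    rintro x ⟨h1, h2⟩
    refine ⟨e x 0, abs_le.1 h2, ?_⟩
    rw [LinearIsometryEquiv.symm_apply_eq]
    ext i
    fin_cases i
    · rfl
    · exact h1.symm
  refine (measure_mono hsub).trans_lt ((hC.hausdorffMeasure_image_le zero_le_one).trans_lt ?_)
  rw [hausdorffMeasure_real]
  simp [ENNReal.mul_lt_top_iff]

/-- The frontier is compact, so local finiteness suffices. Inside a chart ball a frontier point lies
on the graph: strictly above it the point would belong to the open set Ω, and strictly below it the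
point could not be a limit of points of Ω. -/
lemma hausdorffMeasure_frontier_lt_top {Ω : Set Plane} (ho : IsOpen Ω)
    (hb : Bornology.IsBounded Ω) (hc : HasC1Boundary Ω) :
    Measure.hausdorffMeasure 1 (frontier Ω) < ⊤ := by
  have hcomp : IsCompact (frontier Ω) :=
    Metric.isCompact_of_isClosed_isBounded isClosed_frontier
      (hb.closure.subset frontier_subset_closure)
  refine hcomp.measure_lt_top_of_nhdsWithin fun x₀ hx₀ => ?_
  obtain ⟨r, e, h, hr, hh, hΩ⟩ := hc x₀ hx₀
  refine ⟨frontier Ω ∩ Metric.ball x₀ r,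
    inter_mem self_mem_nhdsWithin (mem_nhdsWithin_of_mem_nhds (Metric.ball_mem_nhds _ hr)), ?_⟩
  refine (measure_mono ?_).trans_lt (hausdorffMeasure_graph_lt_top hh e (‖x₀‖ + r))
  rintro x ⟨hx, hxr⟩
  have hcont : Continuous fun x => h (e x 0) := hh.continuous.comp (by fun_prop)
  have hcont' : Continuous fun x => e x 1 := by fun_prop
  refine ⟨le_antisymm ?_ ?_, ?_⟩
  · by_contra! hlt
    have : x ∈ Ω := (hΩ.symm.subset ⟨hxr, hlt⟩).1
    rw [ho.frontier_eq] at hx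
    exact hx.2 this
  · have hcl : x ∈ closure (Metric.ball x₀ r ∩ Ω) :=
      Metric.isOpen_ball.inter_closure ⟨hxr, frontier_subset_closure hx⟩
    refine closure_minimal (t := {x | h (e x 0) ≤ e x 1}) ?_ (isClosed_le hcont hcont') hcl
    rintro y ⟨hy1, hy2⟩
    exact (hΩ.subset ⟨hy2, hy1⟩).2.le
  · have h1 : |e x 0| ≤ ‖e x‖ := by simpa using PiLp.norm_apply_le (e x) 0
    rw [e.norm_map] at h1
    have h2 : ‖x - x₀‖ < r := by simpa [dist_eq_norm] using hxr
    have h3 := norm_add_le (x - x₀) x₀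
    rw [sub_add_cancel] at h3
    linarith

/-! ### Hölder pairings on space-time -/

/-- Fubini applied to the q-th power of the norm. It lets space-time integrability supply test
functions and functionals at almost every fixed time. -/
lemma memLp_slice {X Y H : Type*} {mX : MeasurableSpace X} [NormedAddCommGroup H]
    {q : ℝ≥0∞} {mY : MeasurableSpace Y} {ν : Measure X} {μ : Measure Y}
    [SFinite ν] [SFinite μ]
    {B : X → Y → H} (hq0 : q ≠ 0) (hq : q ≠ ⊤)
    (hB : MemLp (fun z : X × Y => B z.1 z.2) q (ν.prod μ)) :
    ∀ᵐ t ∂ν, MemLp (B t) q μ := by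
  have h1 := (memLp_norm_rpow_iff hB.1 hq0 hq).2 hB
  rw [ENNReal.div_self hq0 hq, memLp_one_iff_integrable] at h1
  filter_upwards [h1.prod_right_ae, hB.1.prodMk_left] with t ht hm
  rw [← memLp_norm_rpow_iff hm hq0 hq, ENNReal.div_self hq0 hq, memLp_one_iff_integrable]
  exact ht

section Pairing

variable {X H : Type*} {mX : MeasurableSpace X} [NormedAddCommGroup H] [InnerProductSpace ℝ H]
  {p q : ℝ≥0∞}

lemma integrable_inner_of_memLp [ENNReal.HolderConjugate p q] {ν : Measure X} {f g : X → H}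
    (hf : MemLp f p ν) (hg : MemLp g q ν) : Integrable (fun x => (inner ℝ (f x) (g x) : ℝ)) ν := by
  refine memLp_one_iff_integrable.1 (MemLp.of_bilin (p := p) (q := q) (fun x y : H => inner ℝ x y)
    1 hf hg (hf.1.inner hg.1) (ae_of_all _ fun x => ?_))
  simpa using nnnorm_inner_le_nnnorm (𝕜 := ℝ) (f x) (g x)

lemma abs_integral_inner_le [ENNReal.HolderConjugate p q] {ν : Measure X} {f g : X → H}
    (hf : MemLp f p ν) (hg : MemLp g q ν) :
    |∫ x, (inner ℝ (f x) (g x) : ℝ) ∂ν| ≤ (eLpNorm f p ν).toReal * (eLpNorm g q ν).toReal := by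
  have h1 := eLpNorm_le_eLpNorm_mul_eLpNorm'_of_norm (p := p) (q := q) (r := 1) hf.1 hg.1
    (fun x y : H => (inner ℝ x y : ℝ)) 1 (ae_of_all _ fun x => by
      simpa using norm_inner_le_norm (𝕜 := ℝ) (f x) (g x))
  rw [ENNReal.coe_one, one_mul] at h1
  rw [← Real.norm_eq_abs, ← ENNReal.toReal_mul]
  refine (norm_integral_le_integral_norm _).trans ?_
  rw [integral_norm_eq_lintegral_enorm (hf.1.inner hg.1), ← eLpNorm_one_eq_lintegral_enorm]
  exact ENNReal.toReal_mono (ENNReal.mul_ne_top hf.2.ne hg.2.ne) h1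

lemma continuous_integral_inner [ENNReal.HolderConjugate p q] [Fact (1 ≤ p)] {ν : Measure X}
    {g : X → H} (hg : MemLp g q ν) :
    Continuous fun e : Lp H p ν => ∫ x, (inner ℝ (e x) (g x) : ℝ) ∂ν := by
  refine continuous_of_linear_of_bound (𝕜 := ℝ) (C := (eLpNorm g q ν).toReal)
    (fun e e' => ?_) (fun c e => ?_) (fun e => ?_)
  · rw [← integral_add (integrable_inner_of_memLp (Lp.memLp e) hg)
      (integrable_inner_of_memLp (Lp.memLp e') hg)]
    refine integral_congr_ae ?_
    filter_upwards [Lp.coeFn_add e e'] with x hx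
    rw [hx, Pi.add_apply, inner_add_left]
  · rw [smul_eq_mul, ← integral_const_mul]
    refine integral_congr_ae ?_
    filter_upwards [Lp.coeFn_smul c e] with x hx
    rw [hx, Pi.smul_apply, real_inner_smul_left]
  · rw [Real.norm_eq_abs, mul_comm, Lp.norm_def]
    exact abs_integral_inner_le (Lp.memLp e) hg

variable {μ : Measure Plane} [IsFiniteMeasure μ]

lemma integrable_inner_slab [ENNReal.HolderConjugate p q] {F : ℝ → Plane → H}
    (hF : MemLp (fun z : ℝ × Plane => F z.1 z.2) p (volume.prod μ)) {g : Plane → H}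
    (hg : MemLp g q μ) (a b : ℝ) :
    Integrable (fun z : ℝ × Plane => (inner ℝ (F z.1 z.2) (g z.2) : ℝ))
      ((volume.restrict (uIoc a b)).prod μ) := by
  have : IsFiniteMeasure ((volume : Measure ℝ).restrict (uIoc a b)) := by
    unfold uIoc; infer_instance
  exact integrable_inner_of_memLp
    (hF.mono_measure (Measure.prod_mono Measure.restrict_le_self le_rfl))
    (hg.comp_snd _)

lemma intervalIntegrable_integral_inner [ENNReal.HolderConjugate p q] {F : ℝ → Plane → H}
    (hF : MemLp (fun z : ℝ × Plane => F z.1 z.2) p (volume.prod μ)) {g : Plane → H}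
    (hg : MemLp g q μ) (a b : ℝ) :
    IntervalIntegrable (fun s => ∫ y, (inner ℝ (F s y) (g y) : ℝ) ∂μ) volume a b := by
  rw [intervalIntegrable_iff]
  exact (integrable_inner_slab hF hg a b).integral_prod_left

/-- Hölder on the slab bounds this linear functional of e, because a function independent of time
has finite L^q norm over a bounded time interval. The continuity is what allows passage from
countably many tests to all of them. -/
lemma continuous_intervalIntegral_inner [ENNReal.HolderConjugate p q] [Fact (1 ≤ q)]
    {F : ℝ → Plane → H}
    (hF : MemLp (fun z : ℝ × Plane => F z.1 z.2) p (volume.prod μ)) (a b : ℝ) :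
    Continuous fun e : Lp H q μ => ∫ s in a..b, ∫ y, (inner ℝ (F s y) (e y) : ℝ) ∂μ := by
  have hfin : IsFiniteMeasure ((volume : Measure ℝ).restrict (uIoc a b)) := by
    unfold uIoc; infer_instance
  set c : ℝ≥0∞ := (volume : Measure ℝ).restrict (uIoc a b) univ with hc
  refine continuous_of_linear_of_bound (𝕜 := ℝ)
    (C := (eLpNorm (fun z : ℝ × Plane => F z.1 z.2) p (volume.prod μ)).toReal
      * (c ^ (1 / q).toReal).toReal) (fun e e' => ?_) (fun r e => ?_) (fun e => ?_)
  · rw [← intervalIntegral.integral_add (intervalIntegrable_integral_inner hF (Lp.memLp e) a b)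
      (intervalIntegrable_integral_inner hF (Lp.memLp e') a b)]
    have h1 := (integrable_inner_slab hF (Lp.memLp e) a b).prod_right_ae
    have h2 := (integrable_inner_slab hF (Lp.memLp e') a b).prod_right_ae
    rw [ae_restrict_iff' measurableSet_uIoc] at h1 h2
    refine intervalIntegral.integral_congr_ae ?_
    filter_upwards [h1, h2] with s h1 h2 hs
    rw [← integral_add (h1 hs) (h2 hs)]
    refine integral_congr_ae ?_
    filter_upwards [Lp.coeFn_add e e'] with x hx
    rw [hx, Pi.add_apply, inner_add_right]
  · rw [smul_eq_mul, ← intervalIntegral.integral_const_mul]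
    refine intervalIntegral.integral_congr fun s _ => ?_
    rw [← integral_const_mul]
    refine integral_congr_ae ?_
    filter_upwards [Lp.coeFn_smul r e] with x hx
    rw [hx, Pi.smul_apply, real_inner_smul_right]
  · have hF' := hF.mono_measure
      (Measure.prod_mono (Measure.restrict_le_self (s := uIoc a b)) (le_refl μ))
    have he := (Lp.memLp e).comp_snd ((volume : Measure ℝ).restrict (uIoc a b))
    -- Pushing the slab measure forward to space gives c • μ, which produces the factor c^(1/q).
    have hn : eLpNorm (fun z : ℝ × Plane => e z.2) q ((volume.restrict (uIoc a b)).prod μ)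
        ≤ c ^ (1 / q).toReal * eLpNorm e q μ := by
      refine le_trans (le_of_eq ?_) (eLpNorm_smul_measure_le c e q μ)
      rw [hc, ← Measure.map_snd_prod, eLpNorm_map_measure _ (by fun_prop)]
      · rfl
      · rw [Measure.map_snd_prod]
        exact (Lp.aestronglyMeasurable e).smul_measure _
    have hc' : c ^ (1 / q).toReal ≠ ⊤ :=
      ENNReal.rpow_ne_top_of_nonneg ENNReal.toReal_nonneg (measure_ne_top _ _)
    have hn' := ENNReal.toReal_mono (ENNReal.mul_ne_top hc' (Lp.memLp e).2.ne) hn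
    rw [ENNReal.toReal_mul, ← Lp.norm_def] at hn'
    rw [Real.norm_eq_abs, intervalIntegral.abs_intervalIntegral_eq,
      ← integral_prod (fun z : ℝ × Plane => (inner ℝ (F z.1 z.2) (e z.2) : ℝ))
        (integrable_inner_slab hF (Lp.memLp e) a b)]
    refine (abs_integral_inner_le hF' he).trans ?_
    rw [mul_assoc]
    refine mul_le_mul (ENNReal.toReal_mono hF.2.ne ?_) hn' ENNReal.toReal_nonneg
      ENNReal.toReal_nonneg
    exact eLpNorm_mono_measure _ (Measure.prod_mono Measure.restrict_le_self le_rfl)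

/-! ### Continuity of translations in time -/

lemma measurePreserving_shift (μ : Measure Plane) [IsFiniteMeasure μ] (r : ℝ) :
    MeasurePreserving (fun z : ℝ × Plane => (z.1 - r, z.2)) (volume.prod μ) (volume.prod μ) :=
  (measurePreserving_sub_right volume r).prod (MeasurePreserving.id μ)

/-- Translation in time is a continuous family of measure-preserving maps, hence acts continuously
on L^p when p < ∞; the pairing with B is a continuous functional. -/
lemma continuous_integral_inner_shift [ENNReal.HolderConjugate p q] [Fact (1 ≤ p)] (hp : p ≠ ⊤)
    {F B : ℝ → Plane → H} (hF : MemLp (fun z : ℝ × Plane => F z.1 z.2) p (volume.prod μ))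
    (hB : MemLp (fun z : ℝ × Plane => B z.1 z.2) q (volume.prod μ)) :
    Continuous fun r : ℝ =>
      ∫ z : ℝ × Plane, (inner ℝ (F (z.1 - r) z.2) (B z.1 z.2) : ℝ) ∂(volume.prod μ) := by
  let g : ℝ → C(ℝ × Plane, ℝ × Plane) := fun r => ⟨fun z => (z.1 - r, z.2), by fun_prop⟩
  have hg : Continuous g := ContinuousMap.continuous_of_continuous_uncurry _
    (by simp only [g, Function.uncurry_def, ContinuousMap.coe_mk]; fun_prop)
  have hgm : ∀ r, MeasurePreserving (g r) (volume.prod μ) (volume.prod μ) :=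
    measurePreserving_shift μ
  have h := (continuous_integral_inner hB).comp
    ((continuous_const (y := hF.toLp)).compMeasurePreservingLp hg hgm hp)
  refine h.congr fun r => integral_congr_ae ?_
  have h1 := (hF.comp_measurePreserving (hgm r)).coeFn_toLp
  filter_upwards [h1] with z hz
  rw [Lp.toLp_compMeasurePreserving, hz]
  rfl

lemma measurePreserving_rotate (ρ : Measure ℝ) [SFinite ρ] (μ : Measure Plane) [SFinite μ] :
    MeasurePreserving (fun z : (ℝ × ℝ) × Plane => (z.1.2, (z.1.1, z.2)))
      (((volume : Measure ℝ).prod ρ).prod μ) (ρ.prod ((volume : Measure ℝ).prod μ)) :=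
  (measurePreserving_prodAssoc ρ volume μ).comp
    (Measure.measurePreserving_swap.prod (MeasurePreserving.id μ))

lemma integrable_inner_shift_prod [ENNReal.HolderConjugate p q]
    {F B : ℝ → Plane → H} (hF : MemLp (fun z : ℝ × Plane => F z.1 z.2) p (volume.prod μ))
    (hB : MemLp (fun z : ℝ × Plane => B z.1 z.2) q (volume.prod μ))
    (ρ : Measure ℝ) [IsFiniteMeasure ρ] :
    Integrable (fun z : (ℝ × ℝ) × Plane =>
      (inner ℝ (F (z.1.1 - z.1.2) z.2) (B z.1.1 z.2) : ℝ)) ((volume.prod ρ).prod μ) := by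
  have hrot := measurePreserving_rotate ρ μ
  -- Shifting time by r for each fixed r is a skew product over the r-variable; joint measurability
  -- and invariance of Hölder norms follow from it.
  have hskew : MeasurePreserving (fun z : ℝ × (ℝ × Plane) => (z.1, (z.2.1 - z.1, z.2.2)))
      (ρ.prod (volume.prod μ)) (ρ.prod (volume.prod μ)) :=
    (MeasurePreserving.id ρ).skew_product (g := fun (r : ℝ) (z : ℝ × Plane) => (z.1 - r, z.2))
      (by simp only [Function.uncurry_def]; fun_prop)
      (ae_of_all _ fun r => (measurePreserving_shift μ r).map_eq)
  exact integrable_inner_of_memLp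
    ((hF.comp_snd ρ).comp_measurePreserving (hskew.comp hrot))
    ((hB.comp_snd ρ).comp_measurePreserving hrot)

/-- Substituting s = t − r turns the moving window (t − h, t) into the fixed range 0 < r ≤ h, after
which Fubini applies. -/
lemma integral_integral_inner_window [ENNReal.HolderConjugate p q]
    {F B : ℝ → Plane → H} (hF : MemLp (fun z : ℝ × Plane => F z.1 z.2) p (volume.prod μ))
    (hB : MemLp (fun z : ℝ × Plane => B z.1 z.2) q (volume.prod μ)) {h : ℝ} (hh : 0 ≤ h) :
    Integrable (fun t => ∫ s in (t - h)..t, ∫ y, (inner ℝ (F s y) (B t y) : ℝ) ∂μ) ∧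
    ∫ t, ∫ s in (t - h)..t, ∫ y, (inner ℝ (F s y) (B t y) : ℝ) ∂μ =
      ∫ r in (0 : ℝ)..h,
        ∫ z : ℝ × Plane, (inner ℝ (F (z.1 - r) z.2) (B z.1 z.2) : ℝ) ∂(volume.prod μ) := by
  set ρ : Measure ℝ := volume.restrict (Ioc 0 h) with hρ
  have hint := integrable_inner_shift_prod hF hB ρ
  have hint' := hint.integral_prod_left
  have hwin : ∀ t, ∫ s in (t - h)..t, ∫ y, (inner ℝ (F s y) (B t y) : ℝ) ∂μ =
      ∫ r, ∫ y, (inner ℝ (F (t - r) y) (B t y) : ℝ) ∂μ ∂ρ := by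
    intro t
    have := intervalIntegral.integral_comp_sub_left (a := 0) (b := h)
      (fun s => ∫ y, (inner ℝ (F s y) (B t y) : ℝ) ∂μ) t
    rw [sub_zero] at this
    rw [← this, intervalIntegral.integral_of_le hh]
  simp only [hwin]
  refine ⟨hint'.integral_prod_left, ?_⟩
  rw [integral_integral_swap hint', intervalIntegral.integral_of_le hh]
  have hslice : ∀ r, Integrable (fun z : ℝ × Plane =>
      (inner ℝ (F (z.1 - r) z.2) (B z.1 z.2) : ℝ)) (volume.prod μ) := fun r =>
    integrable_inner_of_memLp (hF.comp_measurePreserving (measurePreserving_shift μ r)) hB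
  refine integral_congr_ae (ae_of_all _ fun r => ?_)
  exact (integral_prod _ (hslice r)).symm

/-- Backward time averages of `F`, paired with `B`, converge. -/
lemma tendsto_average_integral_inner [ENNReal.HolderConjugate p q] [Fact (1 ≤ p)] (hp : p ≠ ⊤)
    {F B : ℝ → Plane → H} (hF : MemLp (fun z : ℝ × Plane => F z.1 z.2) p (volume.prod μ))
    (hB : MemLp (fun z : ℝ × Plane => B z.1 z.2) q (volume.prod μ)) :
    Tendsto (fun h : ℝ => h⁻¹ *
      ∫ t, ∫ s in (t - h)..t, ∫ y, (inner ℝ (F s y) (B t y) : ℝ) ∂μ) (𝓝[>] 0)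
      (𝓝 (∫ t, ∫ y, (inner ℝ (F t y) (B t y) : ℝ) ∂μ)) := by
  have hc := continuous_integral_inner_shift hp hF hB
  -- The averages are difference quotients at 0 of the primitive of the continuous function r ↦ ⟨F(·
  -- − r), B⟩, so their limit is its value at r = 0.
  have hd := intervalIntegral.integral_hasDerivAt_right (hc.intervalIntegrable 0 0)
    (hc.stronglyMeasurableAtFilter _ _) hc.continuousAt
  have ht := (hasDerivAt_iff_tendsto_slope_zero.1 hd).mono_left
    (nhdsWithin_mono (0 : ℝ) (fun x (hx : x ∈ Ioi 0) => (ne_of_gt hx : x ≠ 0)))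
  simp only [zero_add, intervalIntegral.integral_same, sub_zero, smul_eq_mul] at ht
  rw [integral_prod (fun z : ℝ × Plane => (inner ℝ (F z.1 z.2) (B z.1 z.2) : ℝ))
    (integrable_inner_of_memLp hF hB)] at ht
  refine ht.congr' ?_
  filter_upwards [self_mem_nhdsWithin] with h hh
  rw [(integral_integral_inner_window hF hB (le_of_lt hh)).2]

end Pairing

/-! ### The energy inequality -/

/-- A countable dense subset of A needs only one null set, and continuity extends the identity to
the rest of A. No closedness of A is required. -/
lemma ae_forall_mem_of_continuous {E : Type*} [TopologicalSpace E] [SecondCountableTopology E]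
    {ν : Measure ℝ} (A : Set E) {l r : ℝ → E → ℝ} (hl : ∀ᵐ t ∂ν, Continuous (l t))
    (hr : ∀ᵐ t ∂ν, Continuous (r t)) (h : ∀ e ∈ A, ∀ᵐ t ∂ν, l t e = r t e) :
    ∀ᵐ t ∂ν, ∀ e ∈ A, l t e = r t e := by
  obtain ⟨D, hDc, hDd⟩ := TopologicalSpace.exists_countable_dense A
  have hD : ∀ᵐ t ∂ν, ∀ d ∈ D, l t d = r t d :=
    (ae_ball_iff hDc).2 fun d _ => h d d.2
  filter_upwards [hl, hr, hD] with t h1 h2 h3 e he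
  have := Continuous.ext_on hDd (h1.comp continuous_subtype_val)
    (h2.comp continuous_subtype_val) h3
  exact congrFun this ⟨e, he⟩

lemma memLp_indicator_Ioo {H : Type*} [NormedAddCommGroup H] {T : ℝ} {μ : Measure Plane}
    [SFinite μ] {p : ℝ≥0∞} {F : ℝ → Plane → H}
    (hF : MemLp (fun z : ℝ × Plane => F z.1 z.2) p ((timeMeasure T).prod μ)) :
    MemLp (fun z : ℝ × Plane => (Ioo 0 T).indicator F z.1 z.2) p (volume.prod μ) := by
  have h1 : (timeMeasure T).prod μ = (volume.prod μ).restrict (Ioo 0 T ×ˢ univ) := by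
    rw [timeMeasure, ← Measure.prod_restrict, Measure.restrict_univ]
  rw [h1, ← memLp_indicator_iff_restrict (measurableSet_Ioo.prod MeasurableSet.univ)] at hF
  refine hF.ae_eq (ae_of_all _ fun z => ?_)
  by_cases hz : z.1 ∈ Ioo 0 T
  · simp [hz, indicator]
  · simp [hz, indicator]

/-- The pairing of a triple (density, flux, boundary density) with a triple (function, gradient,
boundary values). -/
def triplePairing (μ κ : Measure Plane) (f : Plane → ℝ) (V : Plane → Plane) (β : Plane → ℝ)
    (ψ : Plane → ℝ) (G : Plane → Plane) (h : Plane → ℝ) : ℝ :=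
  (∫ x, (inner ℝ (f x) (ψ x) : ℝ) ∂μ) + (∫ x, (inner ℝ (V x) (G x) : ℝ) ∂μ)
    + ∫ x, (inner ℝ (β x) (h x) : ℝ) ∂κ

lemma triplePairing_congr {μ κ : Measure Plane} {f : Plane → ℝ} {V : Plane → Plane} {β : Plane → ℝ}
    {ψ ψ' : Plane → ℝ} {G G' : Plane → Plane} {h h' : Plane → ℝ} (hψ : ψ =ᵐ[μ] ψ')
    (hG : G =ᵐ[μ] G') (hh : h =ᵐ[κ] h') :
    triplePairing μ κ f V β ψ G h = triplePairing μ κ f V β ψ' G' h' := by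
  unfold triplePairing
  congr 1
  · congr 1
    · exact integral_congr_ae (hψ.mono fun x hx => by simp only [hx])
    · exact integral_congr_ae (hG.mono fun x hx => by simp only [hx])
  · exact integral_congr_ae (hh.mono fun x hx => by simp only [hx])

lemma triplePairing_zero_left {μ κ : Measure Plane} (ψ : Plane → ℝ) (G : Plane → Plane)
    (h : Plane → ℝ) :
    triplePairing μ κ 0 0 0 ψ G h = 0 := by
  simp [triplePairing]

lemma triplePairing_zero_right {μ κ : Measure Plane} (f : Plane → ℝ) (V : Plane → Plane)
    (β : Plane → ℝ) :
    triplePairing μ κ f V β 0 0 0 = 0 := by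
  simp [triplePairing]

lemma integral_add_add {X : Type*} {mX : MeasurableSpace X} {ν : Measure X} {f g k : X → ℝ}
    (hf : Integrable f ν) (hg : Integrable g ν) (hk : Integrable k ν) :
    ∫ t, (f t + g t + k t) ∂ν = (∫ t, f t ∂ν) + (∫ t, g t ∂ν) + ∫ t, k t ∂ν := by
  rw [← integral_add hf hg]
  exact integral_add (hf.add hg) hk

section Energy

variable {T : ℝ} {μ κ : Measure Plane} [IsFiniteMeasure μ] [IsFiniteMeasure κ] {p q : ℝ≥0∞}
  [ENNReal.HolderConjugate p q] {w F₁ F₃ : ℝ → Plane → ℝ} {F₂ : ℝ → Plane → Plane}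

lemma intervalIntegral_triplePairing
    (hF₁ : MemLp (fun z : ℝ × Plane => F₁ z.1 z.2) 2 (volume.prod μ))
    (hF₂ : MemLp (fun z : ℝ × Plane => F₂ z.1 z.2) q (volume.prod μ))
    (hF₃ : MemLp (fun z : ℝ × Plane => F₃ z.1 z.2) p (volume.prod κ))
    {ψ : Plane → ℝ} {G : Plane → Plane} {h : Plane → ℝ} (hψ : MemLp ψ 2 μ) (hG : MemLp G p μ)
    (hh : MemLp h q κ) (a b : ℝ) :
    IntervalIntegrable (fun s => triplePairing μ κ (F₁ s) (F₂ s) (F₃ s) ψ G h) volume a b ∧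
    ∫ s in a..b, triplePairing μ κ (F₁ s) (F₂ s) (F₃ s) ψ G h =
      (∫ s in a..b, ∫ x, (inner ℝ (F₁ s x) (ψ x) : ℝ) ∂μ) +
      (∫ s in a..b, ∫ x, (inner ℝ (F₂ s x) (G x) : ℝ) ∂μ) +
      ∫ s in a..b, ∫ x, (inner ℝ (F₃ s x) (h x) : ℝ) ∂κ := by
  have : ENNReal.HolderConjugate q p := ENNReal.HolderConjugate.symm
  have i1 := intervalIntegrable_integral_inner hF₁ hψ a b
  have i2 := intervalIntegrable_integral_inner hF₂ hG a b
  have i3 := intervalIntegrable_integral_inner hF₃ hh a b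
  refine ⟨(i1.add i2).add i3, ?_⟩
  rw [← intervalIntegral.integral_add i1 i2, ← intervalIntegral.integral_add (i1.add i2) i3]
  rfl

/-- If the weak identity holds for each test triple for a.e. time, then for a.e. time it holds
for all test triples. -/
lemma ae_forall_test [Fact (1 ≤ p)] [Fact (1 ≤ q)] (hp : p ≠ ⊤) (hq : q ≠ ⊤)
    (hw : MemLp (fun z : ℝ × Plane => w z.1 z.2) 2 (volume.prod μ))
    (hF₁ : MemLp (fun z : ℝ × Plane => F₁ z.1 z.2) 2 (volume.prod μ))
    (hF₂ : MemLp (fun z : ℝ × Plane => F₂ z.1 z.2) q (volume.prod μ))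
    (hF₃ : MemLp (fun z : ℝ × Plane => F₃ z.1 z.2) p (volume.prod κ))
    {Test : (Plane → ℝ) → (Plane → Plane) → (Plane → ℝ) → Prop}
    (htest : ∀ ψ G h, Test ψ G h → MemLp ψ 2 μ → MemLp G p μ → MemLp h q κ →
      ∀ᵐ t ∂(timeMeasure T), ∫ x, (inner ℝ (w t x) (ψ x) : ℝ) ∂μ =
        ∫ s in (0 : ℝ)..t, triplePairing μ κ (F₁ s) (F₂ s) (F₃ s) ψ G h) :
    ∀ᵐ t ∂(timeMeasure T), ∀ ψ G h, Test ψ G h → MemLp ψ 2 μ → MemLp G p μ → MemLp h q κ →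
      ∫ x, (inner ℝ (w t x) (ψ x) : ℝ) ∂μ =
        ∫ s in (0 : ℝ)..t, triplePairing μ κ (F₁ s) (F₂ s) (F₃ s) ψ G h := by
  have : ENNReal.HolderConjugate q p := ENNReal.HolderConjugate.symm
  let E := Lp ℝ 2 μ × Lp Plane p μ × Lp ℝ q κ
  -- Finite exponents make the L^p spaces separable, hence second countable.
  have : Fact (p ≠ ⊤) := ⟨hp⟩
  have : Fact (q ≠ ⊤) := ⟨hq⟩
  have : Fact ((2 : ℝ≥0∞) ≠ ⊤) := ⟨by norm_num⟩
  have s1 : SecondCountableTopology (Lp ℝ 2 μ) := inferInstance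
  have s2 : SecondCountableTopology (Lp Plane p μ) := inferInstance
  have s3 : SecondCountableTopology (Lp ℝ q κ) := inferInstance
  have s4 : SecondCountableTopology E := inferInstanceAs
    (SecondCountableTopology (Lp ℝ 2 μ × Lp Plane p μ × Lp ℝ q κ))
  -- Tests are functions, whereas continuity is available on classes; A collects the classes of
  -- admissible tests.
  let A : Set E := {e | ∃ ψ G h, Test ψ G h ∧ e.1 =ᵐ[μ] ψ ∧ e.2.1 =ᵐ[μ] G ∧ e.2.2 =ᵐ[κ] h}
  let l : ℝ → E → ℝ := fun t e => ∫ x, (inner ℝ (w t x) (e.1 x) : ℝ) ∂μ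
  let r : ℝ → E → ℝ := fun t e =>
    ∫ s in (0 : ℝ)..t, triplePairing μ κ (F₁ s) (F₂ s) (F₃ s) e.1 e.2.1 e.2.2
  have hl : ∀ᵐ t ∂(timeMeasure T), Continuous (l t) := by
    filter_upwards [ae_restrict_of_ae (memLp_slice (by norm_num) (by norm_num) hw)] with t ht
    refine ((continuous_integral_inner (p := 2) ht).comp continuous_fst).congr fun e => ?_
    exact integral_congr_ae (ae_of_all _ fun x => real_inner_comm _ _)
  have hr : ∀ᵐ t ∂(timeMeasure T), Continuous (r t) := by
    refine ae_of_all _ fun t => ?_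
    have c1 := (continuous_intervalIntegral_inner (q := 2) hF₁ 0 t).comp
      (continuous_fst : Continuous fun e : E => e.1)
    have c2 := (continuous_intervalIntegral_inner (q := p) hF₂ 0 t).comp
      ((continuous_fst.comp continuous_snd : Continuous fun e : E => e.2.1))
    have c3 := (continuous_intervalIntegral_inner (q := q) hF₃ 0 t).comp
      ((continuous_snd.comp continuous_snd : Continuous fun e : E => e.2.2))
    refine ((c1.add c2).add c3).congr fun e => ?_
    exact ((intervalIntegral_triplePairing hF₁ hF₂ hF₃ (Lp.memLp e.1) (Lp.memLp e.2.1)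
      (Lp.memLp e.2.2) 0 t).2).symm
  have hcongr : ∀ (e : E) (ψ : Plane → ℝ) (G : Plane → Plane) (h : Plane → ℝ),
      e.1 =ᵐ[μ] ψ → e.2.1 =ᵐ[μ] G → e.2.2 =ᵐ[κ] h → ∀ t,
      l t e = ∫ x, (inner ℝ (w t x) (ψ x) : ℝ) ∂μ ∧
      r t e = ∫ s in (0 : ℝ)..t, triplePairing μ κ (F₁ s) (F₂ s) (F₃ s) ψ G h := by
    intro e ψ G h h1 h2 h3 t
    refine ⟨integral_congr_ae (h1.mono fun x hx => by simp only [hx]), ?_⟩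
    exact intervalIntegral.integral_congr fun s _ => triplePairing_congr h1 h2 h3
  have key := ae_forall_mem_of_continuous A hl hr (by
    rintro e ⟨ψ, G, h, ht, h1, h2, h3⟩
    filter_upwards [htest ψ G h ht ((memLp_congr_ae h1).1 (Lp.memLp _))
      ((memLp_congr_ae h2).1 (Lp.memLp _)) ((memLp_congr_ae h3).1 (Lp.memLp _))] with t hh
    rw [(hcongr e ψ G h h1 h2 h3 t).1, (hcongr e ψ G h h1 h2 h3 t).2, hh])
  filter_upwards [key] with t ht ψ G h hT hψ hG hh
  have h1 := hψ.coeFn_toLp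
  have h2 := hG.coeFn_toLp
  have h3 := hh.coeFn_toLp
  have := ht (hψ.toLp, hG.toLp, hh.toLp) ⟨ψ, G, h, hT, h1, h2, h3⟩
  rwa [(hcongr _ ψ G h h1 h2 h3 t).1, (hcongr _ ψ G h h1 h2 h3 t).2] at this

/-- The limit of the backward time averages of a pairing. -/
lemma tendsto_average_triplePairing [Fact (1 ≤ p)] [Fact (1 ≤ q)] (hp : p ≠ ⊤) (hq : q ≠ ⊤)
    {B₁ B₃ : ℝ → Plane → ℝ} {B₂ : ℝ → Plane → Plane}
    (hF₁ : MemLp (fun z : ℝ × Plane => F₁ z.1 z.2) 2 (volume.prod μ))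
    (hF₂ : MemLp (fun z : ℝ × Plane => F₂ z.1 z.2) q (volume.prod μ))
    (hF₃ : MemLp (fun z : ℝ × Plane => F₃ z.1 z.2) p (volume.prod κ))
    (hB₁ : MemLp (fun z : ℝ × Plane => B₁ z.1 z.2) 2 (volume.prod μ))
    (hB₂ : MemLp (fun z : ℝ × Plane => B₂ z.1 z.2) p (volume.prod μ))
    (hB₃ : MemLp (fun z : ℝ × Plane => B₃ z.1 z.2) q (volume.prod κ)) :
    (∀ h : ℝ, 0 ≤ h → Integrable fun t => ∫ s in (t - h)..t,
      triplePairing μ κ (F₁ s) (F₂ s) (F₃ s) (B₁ t) (B₂ t) (B₃ t)) ∧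
    Tendsto (fun h : ℝ => h⁻¹ * ∫ t, ∫ s in (t - h)..t,
      triplePairing μ κ (F₁ s) (F₂ s) (F₃ s) (B₁ t) (B₂ t) (B₃ t)) (𝓝[>] 0)
      (𝓝 (∫ t, triplePairing μ κ (F₁ t) (F₂ t) (F₃ t) (B₁ t) (B₂ t) (B₃ t))) := by
  have : ENNReal.HolderConjugate q p := ENNReal.HolderConjugate.symm
  have hp0 : p ≠ 0 := (one_pos.trans_le Fact.out).ne'
  have hq0 : q ≠ 0 := (one_pos.trans_le Fact.out).ne'
  have hsplit : ∀ h : ℝ, (fun t => ∫ s in (t - h)..t,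
      triplePairing μ κ (F₁ s) (F₂ s) (F₃ s) (B₁ t) (B₂ t) (B₃ t)) =ᵐ[volume] fun t =>
      (∫ s in (t - h)..t, ∫ x, (inner ℝ (F₁ s x) (B₁ t x) : ℝ) ∂μ) +
      (∫ s in (t - h)..t, ∫ x, (inner ℝ (F₂ s x) (B₂ t x) : ℝ) ∂μ) +
      ∫ s in (t - h)..t, ∫ x, (inner ℝ (F₃ s x) (B₃ t x) : ℝ) ∂κ := by
    intro h
    filter_upwards [memLp_slice (by norm_num) (by norm_num) hB₁, memLp_slice hp0 hp hB₂,
      memLp_slice hq0 hq hB₃] with t h1 h2 h3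
    exact (intervalIntegral_triplePairing hF₁ hF₂ hF₃ h1 h2 h3 _ _).2
  have w1 := fun h hh => integral_integral_inner_window (h := h) hF₁ hB₁ hh
  have w2 := fun h hh => integral_integral_inner_window (h := h) hF₂ hB₂ hh
  have w3 := fun h hh => integral_integral_inner_window (h := h) hF₃ hB₃ hh
  refine ⟨fun h hh => (((w1 h hh).1.add (w2 h hh).1).add (w3 h hh).1).congr (hsplit h).symm, ?_⟩
  have t1 := tendsto_average_integral_inner (by norm_num) hF₁ hB₁
  have t2 := tendsto_average_integral_inner hq hF₂ hB₂
  have t3 := tendsto_average_integral_inner hp hF₃ hB₃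
  have j1 := (integrable_inner_of_memLp hF₁ hB₁).integral_prod_left
  have j2 := (integrable_inner_of_memLp hF₂ hB₂).integral_prod_left
  have j3 := (integrable_inner_of_memLp hF₃ hB₃).integral_prod_left
  have hlim : ∫ t, triplePairing μ κ (F₁ t) (F₂ t) (F₃ t) (B₁ t) (B₂ t) (B₃ t) =
      (∫ t, ∫ x, (inner ℝ (F₁ t x) (B₁ t x) : ℝ) ∂μ) +
      (∫ t, ∫ x, (inner ℝ (F₂ t x) (B₂ t x) : ℝ) ∂μ) +
      ∫ t, ∫ x, (inner ℝ (F₃ t x) (B₃ t x) : ℝ) ∂κ :=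
    integral_add_add j1 j2 j3
  rw [hlim]
  refine ((t1.add t2).add t3).congr' ?_
  filter_upwards [self_mem_nhdsWithin] with h hh
  have hh' : (0 : ℝ) ≤ h := le_of_lt hh
  rw [integral_congr_ae (hsplit h), ← mul_add, ← mul_add,
    integral_add_add (w1 h hh').1 (w2 h hh').1 (w3 h hh').1]

lemma integrable_truncPrim {X : Type*} {mX : MeasurableSpace X} {ν : Measure X} {f : X → ℝ}
    (hf : MemLp f 2 ν) {ε : ℝ} (hε : 0 ≤ ε) : Integrable (fun x => truncPrim ε (f x)) ν := by
  refine ((hf.integrable_sq).div_const 2).mono'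
    ((continuous_truncPrim hε).comp_aestronglyMeasurable hf.1) (ae_of_all _ fun x => ?_)
  rw [Real.norm_of_nonneg (truncPrim_nonneg _)]
  exact truncPrim_le hε _

lemma memLp_trunc {X : Type*} {mX : MeasurableSpace X} {ν : Measure X} {f : X → ℝ} {r : ℝ≥0∞}
    (hf : MemLp f r ν) {ε : ℝ} (hε : 0 ≤ ε) : MemLp (fun x => trunc ε (f x)) r ν :=
  hf.mono ((contDiff_trunc hε).continuous.comp_aestronglyMeasurable hf.1)
    (ae_of_all _ fun _ => abs_trunc_le hε _)

/-- The energy inequality for functions extended by zero outside the time interval. -/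
lemma integral_truncPrim_le_of_zero_outside [Fact (1 ≤ p)] [Fact (1 ≤ q)] (hp : p ≠ ⊤)
    (hq : q ≠ ⊤)
    (hw : MemLp (fun z : ℝ × Plane => w z.1 z.2) 2 (volume.prod μ))
    (hF₁ : MemLp (fun z : ℝ × Plane => F₁ z.1 z.2) 2 (volume.prod μ))
    (hF₂ : MemLp (fun z : ℝ × Plane => F₂ z.1 z.2) q (volume.prod μ))
    (hF₃ : MemLp (fun z : ℝ × Plane => F₃ z.1 z.2) p (volume.prod κ))
    (hw0 : ∀ t ≤ 0, w t = 0) (hF0 : ∀ t ≤ 0, F₁ t = 0 ∧ F₂ t = 0 ∧ F₃ t = 0)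
    {Test : (Plane → ℝ) → (Plane → Plane) → (Plane → ℝ) → Prop}
    (htest : ∀ ψ G h, Test ψ G h → MemLp ψ 2 μ → MemLp G p μ → MemLp h q κ →
      ∀ᵐ t ∂(timeMeasure T), ∫ x, (inner ℝ (w t x) (ψ x) : ℝ) ∂μ =
        ∫ s in (0 : ℝ)..t, triplePairing μ κ (F₁ s) (F₂ s) (F₃ s) ψ G h)
    {ε : ℝ} (hε : 0 ≤ ε) {B₂ : ℝ → Plane → Plane} {B₃ : ℝ → Plane → ℝ}
    (hB₂ : MemLp (fun z : ℝ × Plane => B₂ z.1 z.2) p (volume.prod μ))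
    (hB₃ : MemLp (fun z : ℝ × Plane => B₃ z.1 z.2) q (volume.prod κ))
    (hBt : ∀ᵐ t ∂(timeMeasure T), Test (fun x => trunc ε (w t x)) (B₂ t) (B₃ t)) :
    ∀ᵐ t ∂(timeMeasure T), ∫ x, truncPrim ε (w t x) ∂μ ≤
      ∫ s in (0 : ℝ)..t, triplePairing μ κ (F₁ s) (F₂ s) (F₃ s)
        (fun x => trunc ε (w s x)) (B₂ s) (B₃ s) := by
  have hp0 : p ≠ 0 := (one_pos.trans_le Fact.out).ne'
  have hq0 : q ≠ 0 := (one_pos.trans_le Fact.out).ne'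
  set B₁ : ℝ → Plane → ℝ := fun t x => trunc ε (w t x) with hB₁def
  have hB₁ : MemLp (fun z : ℝ × Plane => B₁ z.1 z.2) 2 (volume.prod μ) := memLp_trunc hw hε
  set y : ℝ → ℝ := fun t => ∫ x, truncPrim ε (w t x) ∂μ with hy
  have hyi : Integrable y := (integrable_truncPrim hw hε).integral_prod_left
  have hy0 : ∀ t ≤ 0, y t = 0 := fun t ht => by simp [hy, hw0 t ht, truncPrim]
  -- the weak identity holds on the whole half line, for all tests at once
  have hid : ∀ᵐ t, t < T → ∀ ψ G h, Test ψ G h → MemLp ψ 2 μ → MemLp G p μ → MemLp h q κ →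
      ∫ x, (inner ℝ (w t x) (ψ x) : ℝ) ∂μ =
        ∫ s in (0 : ℝ)..t, triplePairing μ κ (F₁ s) (F₂ s) (F₃ s) ψ G h := by
    have := (ae_restrict_iff' measurableSet_Ioo).1 (ae_forall_test hp hq hw hF₁ hF₂ hF₃ htest)
    filter_upwards [this] with t ht htT ψ G h hT hψ hG hh
    rcases le_or_gt t 0 with h0 | h0
    · rw [hw0 t h0, intervalIntegral.integral_congr (g := fun _ => (0 : ℝ))]
      · simp
      · intro s hs
        rw [uIcc_of_ge h0] at hs
        obtain ⟨e1, e2, e3⟩ := hF0 s hs.2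
        simp only [e1, e2, e3]
        exact triplePairing_zero_left ψ G h
    · exact ht ⟨h0, htT⟩ ψ G h hT hψ hG hh
  have hslices : ∀ᵐ t, MemLp (w t) 2 μ := memLp_slice (by norm_num) (by norm_num) hw
  -- the difference quotient in time, tested with the truncation
  have hdiff : ∀ h : ℝ, 0 < h → ∀ᵐ t, t ∈ Ioo 0 T → y t - y (t - h) ≤
      ∫ s in (t - h)..t, triplePairing μ κ (F₁ s) (F₂ s) (F₃ s) (B₁ t) (B₂ t) (B₃ t) := by
    intro h hh
    -- Translation preserves null sets, so the identity is available at t and at t − h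
    -- simultaneously for almost every t.
    have hqm := (measurePreserving_sub_right (volume : Measure ℝ) h).quasiMeasurePreserving
    filter_upwards [hid, hqm.ae hid, (ae_restrict_iff' measurableSet_Ioo).1 hBt, hslices,
      hqm.ae hslices, memLp_slice (by norm_num) (by norm_num) hB₁, memLp_slice hp0 hp hB₂,
      memLp_slice hq0 hq hB₃] with t h1 h2 h3 h4 h5 h6 h7 h8 htT
    have e1 := h1 htT.2 _ _ _ (h3 htT) h6 h7 h8
    have e2 := h2 (by linarith [htT.2]) _ _ _ (h3 htT) h6 h7 h8
    have hii := fun a b => (intervalIntegral_triplePairing hF₁ hF₂ hF₃ h6 h7 h8 a b).1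
    rw [← intervalIntegral.integral_interval_sub_left (hii 0 t) (hii 0 (t - h)), ← e1, ← e2,
      ← integral_sub (integrable_inner_of_memLp (p := 2) h4 h6)
        (integrable_inner_of_memLp (p := 2) h5 h6),
      hy, ← integral_sub (integrable_truncPrim h4 hε) (integrable_truncPrim h5 hε)]
    -- Pointwise convexity of Θ replaces the chain rule in time.
    refine integral_mono ((integrable_truncPrim h4 hε).sub (integrable_truncPrim h5 hε))
      ((integrable_inner_of_memLp (p := 2) h4 h6).sub
        (integrable_inner_of_memLp (p := 2) h5 h6)) fun x => ?_
    have := truncPrim_sub_le hε (w t x) (w (t - h) x)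
    simp only [RCLike.inner_apply, conj_trivial]
    linarith
  -- Lebesgue differentiation: the final time is taken where y is the derivative of its primitive.
  have hder := (ae_restrict_of_ae (s := Ioo 0 T)
    (LocallyIntegrable.ae_hasDerivAt_integral hyi.locallyIntegrable))
  filter_upwards [hder, ae_restrict_mem measurableSet_Ioo] with t₁ hd ht₁
  -- cut off the tests at `t₁`
  set C₁ : ℝ → Plane → ℝ := (Ioo 0 t₁).indicator B₁ with hC₁
  set C₂ : ℝ → Plane → Plane := (Ioo 0 t₁).indicator B₂ with hC₂
  set C₃ : ℝ → Plane → ℝ := (Ioo 0 t₁).indicator B₃ with hC₃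
  have hrestr : ∀ ν : Measure Plane, SFinite ν → (timeMeasure t₁).prod ν ≤ volume.prod ν :=
    fun ν _ => Measure.prod_mono Measure.restrict_le_self le_rfl
  obtain ⟨hWi, hWt⟩ := tendsto_average_triplePairing hp hq hF₁ hF₂ hF₃
    (memLp_indicator_Ioo (T := t₁) (hB₁.mono_measure (hrestr μ inferInstance)))
    (memLp_indicator_Ioo (T := t₁) (hB₂.mono_measure (hrestr μ inferInstance)))
    (memLp_indicator_Ioo (T := t₁) (hB₃.mono_measure (hrestr κ inferInstance)))
  have hcut : ∀ f : Plane → ℝ, ∀ V : Plane → Plane, ∀ β : Plane → ℝ, ∀ t,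
      triplePairing μ κ f V β (C₁ t) (C₂ t) (C₃ t) =
        (Ioo 0 t₁).indicator (fun t => triplePairing μ κ f V β (B₁ t) (B₂ t) (B₃ t)) t := by
    intro f V β t
    by_cases ht : t ∈ Ioo 0 t₁
    · simp only [hC₁, hC₂, hC₃, indicator_of_mem ht]
    · simp only [hC₁, hC₂, hC₃, indicator_of_notMem ht]
      exact triplePairing_zero_right f V β
  have hlim : ∫ t, triplePairing μ κ (F₁ t) (F₂ t) (F₃ t) (C₁ t) (C₂ t) (C₃ t) =
      ∫ s in (0 : ℝ)..t₁, triplePairing μ κ (F₁ s) (F₂ s) (F₃ s) (B₁ s) (B₂ s) (B₃ s) := by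
    rw [intervalIntegral.integral_of_le ht₁.1.le, integral_Ioc_eq_integral_Ioo,
      ← integral_indicator measurableSet_Ioo]
    refine integral_congr_ae (ae_of_all _ fun t => ?_)
    simp only [hcut]
    by_cases ht : t ∈ Ioo 0 t₁
    · simp only [indicator_of_mem ht]
    · simp only [indicator_of_notMem ht]
  rw [← hlim]
  -- the averages of the energy
  have hslope : Tendsto (fun h : ℝ => h⁻¹ * ∫ t in (t₁ - h)..t₁, y t) (𝓝[>] 0) (𝓝 (y t₁)) := by
    have h1 := (hasDerivAt_iff_tendsto_slope_zero.1 (hd 0))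
    -- Negative increments turn the slope of the primitive into the backward average.
    have hneg : Tendsto (fun h : ℝ => -h) (𝓝[>] 0) (𝓝[≠] 0) := by
      refine tendsto_nhdsWithin_iff.2 ⟨?_, ?_⟩
      · simpa using (tendsto_neg (0 : ℝ)).mono_left nhdsWithin_le_nhds
      · filter_upwards [self_mem_nhdsWithin] with h hh
        exact neg_ne_zero.2 (ne_of_gt hh)
    refine (h1.comp hneg).congr fun h => ?_
    simp only [Function.comp, smul_eq_mul, ← sub_eq_add_neg]
    rw [intervalIntegral.integral_interval_sub_left hyi.intervalIntegrable
      hyi.intervalIntegrable, intervalIntegral.integral_symm, inv_neg, neg_mul_neg]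
  refine le_of_tendsto_of_tendsto hslope hWt ?_
  filter_upwards [self_mem_nhdsWithin] with h hh
  refine mul_le_mul_of_nonneg_left ?_ (inv_nonneg.2 (le_of_lt hh))
  have hys : Integrable fun t => y (t - h) := hyi.comp_sub_right h
  -- The integral of y(t) − y(t − h) telescopes; the contribution from (−h, 0) vanishes, and this is
  -- where the zero initial value enters.
  have e1 : ∫ t in (t₁ - h)..t₁, y t = ∫ t in (0 : ℝ)..t₁, (y t - y (t - h)) := by
    rw [intervalIntegral.integral_sub hyi.intervalIntegrable hys.intervalIntegrable,
      intervalIntegral.integral_comp_sub_right, zero_sub]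
    have z : ∫ t in (-h)..0, y t = 0 := by
      rw [intervalIntegral.integral_congr (g := fun _ => (0 : ℝ))]
      · simp
      · intro t ht
        rw [uIcc_of_le (by linarith [show (0 : ℝ) < h from hh])] at ht
        exact hy0 t ht.2
    have a1 := intervalIntegral.integral_add_adjacent_intervals (μ := volume) (a := -h) (b := 0)
      (c := t₁) (f := y) hyi.intervalIntegrable hyi.intervalIntegrable
    have a2 := intervalIntegral.integral_add_adjacent_intervals (μ := volume) (a := -h)
      (b := t₁ - h) (c := t₁) (f := y) hyi.intervalIntegrable hyi.intervalIntegrable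
    linarith
  rw [e1, intervalIntegral.integral_of_le ht₁.1.le, integral_Ioc_eq_integral_Ioo,
    ← integral_indicator measurableSet_Ioo]
  refine integral_mono_ae ((hyi.sub hys).indicator measurableSet_Ioo) (hWi h (le_of_lt hh)) ?_
  filter_upwards [hdiff h hh] with t ht
  change (Ioo 0 t₁).indicator (fun t => y t - y (t - h)) t ≤ ∫ s in (t - h)..t,
    triplePairing μ κ (F₁ s) (F₂ s) (F₃ s) (C₁ t) (C₂ t) (C₃ t)
  simp only [hcut]
  by_cases hm : t ∈ Ioo 0 t₁
  · simpa only [indicator_of_mem hm] using ht ⟨hm.1, hm.2.trans ht₁.2⟩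
  · simp [indicator_of_notMem hm]

/-- The energy inequality: if the weak time derivative of `w` is the triple `(F₁, F₂, F₃)`, `w`
has zero initial value, and the truncation of `w` is an admissible test, then the energy is
bounded by the time integral of the pairing of `(F₁, F₂, F₃)` with the truncation of `w`. -/
theorem integral_truncPrim_le [Fact (1 ≤ p)] [Fact (1 ≤ q)] (hp : p ≠ ⊤) (hq : q ≠ ⊤)
    (hw : MemLp (fun z : ℝ × Plane => w z.1 z.2) 2 ((timeMeasure T).prod μ))
    (hF₁ : MemLp (fun z : ℝ × Plane => F₁ z.1 z.2) 2 ((timeMeasure T).prod μ))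
    (hF₂ : MemLp (fun z : ℝ × Plane => F₂ z.1 z.2) q ((timeMeasure T).prod μ))
    (hF₃ : MemLp (fun z : ℝ × Plane => F₃ z.1 z.2) p ((timeMeasure T).prod κ))
    {Test : (Plane → ℝ) → (Plane → Plane) → (Plane → ℝ) → Prop}
    (htest : ∀ ψ G h, Test ψ G h → MemLp ψ 2 μ → MemLp G p μ → MemLp h q κ →
      ∀ᵐ t ∂(timeMeasure T), ∫ x, (inner ℝ (w t x) (ψ x) : ℝ) ∂μ =
        ∫ s in (0 : ℝ)..t, triplePairing μ κ (F₁ s) (F₂ s) (F₃ s) ψ G h)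
    {ε : ℝ} (hε : 0 ≤ ε) {B₂ : ℝ → Plane → Plane} {B₃ : ℝ → Plane → ℝ}
    (hB₂ : MemLp (fun z : ℝ × Plane => B₂ z.1 z.2) p ((timeMeasure T).prod μ))
    (hB₃ : MemLp (fun z : ℝ × Plane => B₃ z.1 z.2) q ((timeMeasure T).prod κ))
    (hBt : ∀ᵐ t ∂(timeMeasure T), Test (fun x => trunc ε (w t x)) (B₂ t) (B₃ t)) :
    ∀ᵐ t ∂(timeMeasure T), ∫ x, truncPrim ε (w t x) ∂μ ≤
      ∫ s in (0 : ℝ)..t, triplePairing μ κ (F₁ s) (F₂ s) (F₃ s)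
        (fun x => trunc ε (w s x)) (B₂ s) (B₃ s) := by
  have hmem : ∀ {t s : ℝ}, t ∈ Ioo 0 T → s ∈ uIoc 0 t → s ∈ Ioo 0 T := by
    intro t s ht hs
    rw [uIoc_of_le ht.1.le] at hs
    exact ⟨hs.1, hs.2.trans_lt ht.2⟩
  have hout : ∀ {t : ℝ}, t ≤ 0 → t ∉ Ioo 0 T := fun h0 h => absurd h.1 (not_lt.2 h0)
  have key := integral_truncPrim_le_of_zero_outside (T := T) (Test := Test) hp hq
    (memLp_indicator_Ioo hw) (memLp_indicator_Ioo hF₁) (memLp_indicator_Ioo hF₂)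
    (memLp_indicator_Ioo hF₃) (fun t ht => indicator_of_notMem (hout ht) _)
    (fun t ht => ⟨indicator_of_notMem (hout ht) _, indicator_of_notMem (hout ht) _,
      indicator_of_notMem (hout ht) _⟩)
    (fun ψ G h hT hψ hG hh => by
      filter_upwards [htest ψ G h hT hψ hG hh, ae_restrict_mem measurableSet_Ioo] with t ht hm
      rw [indicator_of_mem hm, ht]
      refine intervalIntegral.integral_congr_ae (ae_of_all _ fun s hs => ?_)
      simp only [indicator_of_mem (hmem hm hs)])
    hε (memLp_indicator_Ioo hB₂) (memLp_indicator_Ioo hB₃)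
    (by
      filter_upwards [hBt, ae_restrict_mem measurableSet_Ioo] with t ht hm
      simpa only [indicator_of_mem hm] using ht)
  filter_upwards [key, ae_restrict_mem measurableSet_Ioo] with t ht hm
  rw [indicator_of_mem hm] at ht
  refine ht.trans_eq (intervalIntegral.integral_congr_ae (ae_of_all _ fun s hs => ?_))
  simp only [indicator_of_mem (hmem hm hs)]

end Energy

/-! ### Weak gradients and traces -/

section Sobolev

variable {Ω : Set Plane} {p q : ℝ≥0∞}

lemma gradient_sub_of_contDiff {f g : Plane → ℝ} (hf : ContDiff ℝ ∞ f) (hg : ContDiff ℝ ∞ g)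
    (x : Plane) : gradient (fun y => f y - g y) x = gradient f x - gradient g x := by
  unfold gradient
  rw [fderiv_fun_sub (hf.differentiable (by simp) x) (hg.differentiable (by simp) x), map_sub]

lemma gradient_comp_of_contDiff {θ : ℝ → ℝ} {f : Plane → ℝ} (hθ : ContDiff ℝ ∞ θ)
    (hf : ContDiff ℝ ∞ f) (x : Plane) :
    gradient (fun y => θ (f y)) x = deriv θ (f x) • gradient f x := by
  have h1 := (hθ.differentiable (by simp) (f x)).hasDerivAt.comp_hasFDerivAt x
    (hf.differentiable (by simp) x).hasFDerivAt
  unfold gradient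
  rw [show fderiv ℝ (fun y => θ (f y)) x = deriv θ (f x) • fderiv ℝ f x from h1.fderiv, map_smul]

lemma continuous_gradient_of_contDiff {f : Plane → ℝ} (hf : ContDiff ℝ ∞ f) :
    Continuous (gradient f) :=
  (InnerProductSpace.toDual ℝ Plane).symm.continuous.comp (hf.continuous_fderiv (by simp))

/-- Dominated convergence to zero in `L^p`. -/
lemma tendsto_eLpNorm_zero_of_dominated {X E : Type*} {mX : MeasurableSpace X}
    [NormedAddCommGroup E] {ν : Measure X} (hp0 : p ≠ 0) (hp : p ≠ ⊤) {g : ℕ → X → E}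
    {G : X → E} (hg : ∀ n, AEStronglyMeasurable (g n) ν) (hG : MemLp G p ν)
    (hle : ∀ n x, ‖g n x‖ ≤ ‖G x‖) (hlim : ∀ᵐ x ∂ν, Tendsto (fun n => g n x) atTop (𝓝 0)) :
    Tendsto (fun n => eLpNorm (g n) p ν) atTop (𝓝 0) := by
  have hpos : 0 < p.toReal := ENNReal.toReal_pos hp0 hp
  simp only [eLpNorm_eq_lintegral_rpow_enorm_toReal hp0 hp]
  have hz : Tendsto (fun n => ∫⁻ x, ‖g n x‖ₑ ^ p.toReal ∂ν) atTop (𝓝 0) := by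
    have := tendsto_lintegral_of_dominated_convergence' (μ := ν)
      (F := fun n x => ‖g n x‖ₑ ^ p.toReal) (f := fun _ => 0) (fun x => ‖G x‖ₑ ^ p.toReal)
      (fun n => (hg n).enorm.pow_const _)
      (fun n => ae_of_all _ fun x => ENNReal.rpow_le_rpow (by
        rw [← ofReal_norm, ← ofReal_norm]
        exact ENNReal.ofReal_le_ofReal (hle n x)) hpos.le)
      (lintegral_rpow_enorm_lt_top_of_eLpNorm_lt_top hp0 hp hG.2).ne
      (by
        filter_upwards [hlim] with x hx
        have h1 : Tendsto (fun n => ‖g n x‖ₑ) atTop (𝓝 0) := by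
          simpa using hx.enorm
        simpa [ENNReal.zero_rpow_of_pos hpos] using h1.ennrpow_const p.toReal)
    simpa using this
  have := hz.ennrpow_const (1 / p.toReal)
  rwa [ENNReal.zero_rpow_of_pos (by positivity)] at this

lemma tendsto_eLpNorm_zero_add {X E : Type*} {mX : MeasurableSpace X}
    [NormedAddCommGroup E] {ν : Measure X} (hp1 : 1 ≤ p) {f g k : ℕ → X → E}
    (hf : ∀ n, AEStronglyMeasurable (f n) ν) (hg : ∀ n, AEStronglyMeasurable (g n) ν)
    (hk : ∀ n x, ‖k n x‖ ≤ ‖f n x + g n x‖)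
    (hf0 : Tendsto (fun n => eLpNorm (f n) p ν) atTop (𝓝 0))
    (hg0 : Tendsto (fun n => eLpNorm (g n) p ν) atTop (𝓝 0)) :
    Tendsto (fun n => eLpNorm (k n) p ν) atTop (𝓝 0) := by
  have h := hf0.add hg0
  rw [add_zero] at h
  refine tendsto_of_tendsto_of_tendsto_of_le_of_le tendsto_const_nhds h
    (fun _ => zero_le) fun n => ?_
  exact (eLpNorm_mono (hk n)).trans (eLpNorm_add_le (hf n) (hg n) hp1)

lemma IsTrace.sub {f₁ f₂ h₁ h₂ : Plane → ℝ} {G₁ G₂ : Plane → Plane} (hp1 : 1 ≤ p)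
    (hf₁ : MemLp f₁ p (volume.restrict Ω)) (hf₂ : MemLp f₂ p (volume.restrict Ω))
    (hG₁ : MemLp G₁ p (volume.restrict Ω)) (hG₂ : MemLp G₂ p (volume.restrict Ω))
    (ht₁ : IsTrace Ω p f₁ G₁ h₁) (ht₂ : IsTrace Ω p f₂ G₂ h₂) :
    IsTrace Ω p (fun x => f₁ x - f₂ x) (fun x => G₁ x - G₂ x) (fun x => h₁ x - h₂ x) := by
  obtain ⟨m₁, ζ, hζ, a1, a2, a3⟩ := ht₁
  obtain ⟨m₂, ξ, hξ, b1, b2, b3⟩ := ht₂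
  refine ⟨m₁.sub m₂, fun n x => ζ n x - ξ n x, fun n => (hζ n).sub (hξ n), ?_, ?_, ?_⟩
  · exact tendsto_eLpNorm_zero_add hp1
      (f := fun n x => ζ n x - f₁ x) (g := fun n x => f₂ x - ξ n x)
      (fun n => (hζ n).continuous.aestronglyMeasurable.sub hf₁.1)
      (fun n => hf₂.1.sub (hξ n).continuous.aestronglyMeasurable)
      (fun n x => le_of_eq (congrArg _ (by ring))) a1
      (b1.congr fun n => eLpNorm_sub_comm (ξ n) f₂ p _)
  · exact tendsto_eLpNorm_zero_add hp1
      (f := fun n x => gradient (ζ n) x - G₁ x) (g := fun n x => G₂ x - gradient (ξ n) x)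
      (fun n => (continuous_gradient_of_contDiff (hζ n)).aestronglyMeasurable.sub hG₁.1)
      (fun n => hG₂.1.sub (continuous_gradient_of_contDiff (hξ n)).aestronglyMeasurable)
      (fun n x => le_of_eq (congrArg _ (by
        rw [gradient_sub_of_contDiff (hζ n) (hξ n), sub_sub_sub_comm, sub_eq_add_neg, neg_sub]))) a2
      (b2.congr fun n => eLpNorm_sub_comm (gradient (ξ n)) G₂ p _)
  · exact tendsto_eLpNorm_zero_add hp1
      (f := fun n x => ζ n x - h₁ x) (g := fun n x => h₂ x - ξ n x)
      (fun n => (hζ n).continuous.aestronglyMeasurable.sub m₁.1)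
      (fun n => m₂.1.sub (hξ n).continuous.aestronglyMeasurable)
      (fun n x => le_of_eq (congrArg _ (by ring))) a3
      (b3.congr fun n => eLpNorm_sub_comm (ξ n) h₂ p _)

lemma norm_deriv_trunc_le {ε : ℝ} (hε : 0 ≤ ε) (s : ℝ) : ‖deriv (trunc ε) s‖ ≤ 1 := by
  rw [Real.norm_of_nonneg (deriv_trunc_nonneg hε s)]
  exact deriv_trunc_le_one hε s

lemma continuous_deriv_trunc {ε : ℝ} (hε : 0 ≤ ε) : Continuous (deriv (trunc ε)) :=
  (contDiff_trunc hε).continuous_deriv (by simp)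

lemma memLp_deriv_trunc_smul {X : Type*} {mX : MeasurableSpace X} {ν : Measure X}
    {f : X → ℝ} {G : X → Plane} (hf : AEStronglyMeasurable f ν) (hG : MemLp G p ν)
    {ε : ℝ} (hε : 0 ≤ ε) : MemLp (fun x => deriv (trunc ε) (f x) • G x) p ν := by
  refine hG.mono (((continuous_deriv_trunc hε).comp_aestronglyMeasurable hf).smul hG.1)
    (ae_of_all _ fun x => ?_)
  rw [norm_smul]
  exact mul_le_of_le_one_left (norm_nonneg _) (norm_deriv_trunc_le hε _)

/-- The chain rule for the truncation, with traces. -/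
lemma IsTrace.trunc_comp {f h : Plane → ℝ} {G : Plane → Plane} (hp1 : 1 ≤ p) (hp : p ≠ ⊤)
    (hf : MemLp f p (volume.restrict Ω)) (hG : MemLp G p (volume.restrict Ω))
    (ht : IsTrace Ω p f G h) {ε : ℝ} (hε : 0 ≤ ε) :
    IsTrace Ω p (fun x => trunc ε (f x)) (fun x => deriv (trunc ε) (f x) • G x)
      (fun x => trunc ε (h x)) := by
  have hp0 : p ≠ 0 := (one_pos.trans_le hp1).ne'
  obtain ⟨m, ζ, hζ, a1, a2, a3⟩ := ht
  have hθ := contDiff_trunc hε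
  have hlip : ∀ s t, ‖trunc ε s - trunc ε t‖ ≤ ‖s - t‖ := fun s t => by
    simpa [dist_eq_norm] using (lipschitzWith_trunc hε).dist_le_mul s t
  have hmeas : TendstoInMeasure (volume.restrict Ω) ζ atTop f :=
    tendstoInMeasure_of_tendsto_eLpNorm hp0
      (fun n => (hζ n).continuous.aestronglyMeasurable) hf.1 a1
  -- The values and traces converge by the Lipschitz bound alone, but θ'(ζₙ) → θ'(f) is needed
  -- pointwise, hence the a.e. convergent subsequence.
  obtain ⟨ns, hns, hae⟩ := hmeas.exists_seq_tendsto_ae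
  have hsq : ∀ {ν : Measure Plane} {k : Plane → ℝ},
      Tendsto (fun n => eLpNorm (fun x => ζ n x - k x) p ν) atTop (𝓝 0) →
      Tendsto (fun n => eLpNorm (fun x => trunc ε (ζ (ns n) x) - trunc ε (k x)) p ν)
        atTop (𝓝 0) := fun hk =>
    tendsto_of_tendsto_of_tendsto_of_le_of_le tendsto_const_nhds (hk.comp hns.tendsto_atTop)
      (fun _ => zero_le) fun n => eLpNorm_mono fun x => hlip _ _
  refine ⟨memLp_trunc m hε, fun n x => trunc ε (ζ (ns n) x),
    fun n => hθ.comp (hζ (ns n)), hsq a1, ?_, hsq a3⟩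
  have hd := continuous_deriv_trunc hε
  have mG : ∀ n, AEStronglyMeasurable (gradient (ζ n)) (volume.restrict Ω) := fun n =>
    (continuous_gradient_of_contDiff (hζ n)).aestronglyMeasurable
  have mζ : ∀ n, AEStronglyMeasurable (fun x => deriv (trunc ε) (ζ n x)) (volume.restrict Ω) :=
    fun n => (hd.comp (hζ n).continuous).aestronglyMeasurable
  have mf : AEStronglyMeasurable (fun x => deriv (trunc ε) (f x)) (volume.restrict Ω) :=
    hd.comp_aestronglyMeasurable hf.1
  -- The error splits as θ'(ζₙ)(∇ζₙ − G) + (θ'(ζₙ) − θ'(f))G. The first term is controlled by 0 ≤ θ'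
  -- ≤ 1, the second by dominated convergence with majorant |G|.
  refine tendsto_eLpNorm_zero_add hp1
    (f := fun n x => deriv (trunc ε) (ζ (ns n) x) • (gradient (ζ (ns n)) x - G x))
    (g := fun n x => (deriv (trunc ε) (ζ (ns n) x) - deriv (trunc ε) (f x)) • G x)
    (fun n => (mζ _).smul ((mG _).sub hG.1)) (fun n => ((mζ _).sub mf).smul hG.1)
    (fun n x => le_of_eq (congrArg _ ?_)) ?_ ?_
  · rw [gradient_comp_of_contDiff hθ (hζ _), smul_sub, sub_smul]; abel
  · refine tendsto_of_tendsto_of_tendsto_of_le_of_le tendsto_const_nhds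
      (a2.comp hns.tendsto_atTop) (fun _ => zero_le) fun n => eLpNorm_mono fun x => ?_
    rw [norm_smul]
    exact mul_le_of_le_one_left (norm_nonneg _) (norm_deriv_trunc_le hε _)
  · refine tendsto_eLpNorm_zero_of_dominated hp0 hp (fun n => ((mζ _).sub mf).smul hG.1) hG
      (fun n x => ?_) ?_
    · rw [norm_smul]
      refine mul_le_of_le_one_left (norm_nonneg _) ?_
      have h1 := deriv_trunc_nonneg hε (ζ (ns n) x)
      have h2 := deriv_trunc_le_one hε (ζ (ns n) x)
      have h3 := deriv_trunc_nonneg hε (f x)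
      have h4 := deriv_trunc_le_one hε (f x)
      rw [Real.norm_eq_abs, abs_le]
      constructor <;> linarith
    · filter_upwards [hae] with x hx
      have h1 := ((hd.tendsto (f x)).comp hx).sub_const (deriv (trunc ε) (f x))
      simpa using h1.smul_const (G x)

lemma memLp_of_contDiff_hasCompactSupport {ν : Measure Plane} [IsFiniteMeasureOnCompacts ν]
    {η : Plane → ℝ} (hη : ContDiff ℝ ∞ η) (hc : HasCompactSupport η) : MemLp η q ν :=
  hη.continuous.memLp_of_hasCompactSupport hc

lemma memLp_fderiv_of_hasCompactSupport {ν : Measure Plane} [IsFiniteMeasureOnCompacts ν]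
    {η : Plane → ℝ} (hη : ContDiff ℝ ∞ η) (hc : HasCompactSupport η) (e : Plane) :
    MemLp (fun x => fderiv ℝ η x e) q ν :=
  ((hη.continuous_fderiv (by simp)).clm_apply continuous_const).memLp_of_hasCompactSupport
    (hc.fderiv_apply (𝕜 := ℝ) e)

/-- Integration by parts for functions that are smooth up to the boundary. -/
lemma setIntegral_mul_fderiv_of_contDiff {ζ η : Plane → ℝ}
    (hζ : ContDiff ℝ ∞ ζ) (hη : ContDiff ℝ ∞ η) (hc : HasCompactSupport η)
    (hs : tsupport η ⊆ Ω) (e : Plane) :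
    ∫ x in Ω, ζ x * fderiv ℝ η x e = - ∫ x in Ω, inner ℝ (gradient ζ x) e * η x := by
  have hd : Continuous fun x => fderiv ℝ η x e :=
    (hη.continuous_fderiv (by simp)).clm_apply continuous_const
  have hd' : Continuous fun x => fderiv ℝ ζ x e :=
    (hζ.continuous_fderiv (by simp)).clm_apply continuous_const
  have hc' : HasCompactSupport fun x => fderiv ℝ η x e := hc.fderiv_apply (𝕜 := ℝ) e
  -- Both integrands vanish off the support of η, so integration by parts takes place on the whole
  -- plane and Ω needs no regularity.
  rw [setIntegral_eq_integral_of_forall_compl_eq_zero,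
    setIntegral_eq_integral_of_forall_compl_eq_zero]
  · simp only [inner_gradient_left]
    exact integral_mul_fderiv_eq_neg_fderiv_mul_of_integrable
      ((hd'.mul hη.continuous).integrable_of_hasCompactSupport hc.mul_left)
      ((hζ.continuous.mul hd).integrable_of_hasCompactSupport hc'.mul_left)
      ((hζ.continuous.mul hη.continuous).integrable_of_hasCompactSupport hc.mul_left)
      (fun x _ => hζ.differentiable (by simp) x) (fun x _ => hη.differentiable (by simp) x)
  · intro x hx
    rw [image_eq_zero_of_notMem_tsupport fun h => hx (hs h), mul_zero]
  · intro x hx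
    have : x ∉ tsupport (fderiv ℝ η) := fun h => hx (hs (tsupport_fderiv_subset ℝ h))
    rw [image_eq_zero_of_notMem_tsupport this]
    simp

/-- Functions with a trace are Sobolev functions. -/
lemma IsTrace.isSobolev [ENNReal.HolderConjugate p q] {f h : Plane → ℝ}
    {G : Plane → Plane}
    (hf : MemLp f p (volume.restrict Ω)) (hG : MemLp G p (volume.restrict Ω))
    (ht : IsTrace Ω p f G h) : IsSobolev Ω p f G := by
  refine ⟨hf, hG, fun η hη hc hs e => ?_⟩
  obtain ⟨-, ζ, hζ, a1, a2, -⟩ := ht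
  have hlim : ∀ {E : Type} [NormedAddCommGroup E] [InnerProductSpace ℝ E] {k : Plane → E}
      {ξ : ℕ → Plane → E} {g : Plane → E}, MemLp k p (volume.restrict Ω) →
      (∀ n, AEStronglyMeasurable (ξ n) (volume.restrict Ω)) →
      Tendsto (fun n => eLpNorm (fun x => ξ n x - k x) p (volume.restrict Ω)) atTop (𝓝 0) →
      MemLp g q (volume.restrict Ω) →
      Tendsto (fun n => ∫ x in Ω, (inner ℝ (ξ n x) (g x) : ℝ)) atTop
        (𝓝 (∫ x in Ω, (inner ℝ (k x) (g x) : ℝ))) := by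
    intro E _ _ k ξ g hk hξ hξk hg
    rw [← tendsto_sub_nhds_zero_iff]
    have hup : Tendsto (fun n => (eLpNorm (fun x => ξ n x - k x) p (volume.restrict Ω)).toReal
        * (eLpNorm g q (volume.restrict Ω)).toReal) atTop (𝓝 0) := by
      have := (ENNReal.tendsto_toReal ENNReal.zero_ne_top).comp hξk
      simpa using this.mul_const _
    refine squeeze_zero_norm' ?_ hup
    -- The approximants are not assumed to be in L^p; a finite distance to k gives this eventually.
    filter_upwards [hξk.eventually (gt_mem_nhds ENNReal.zero_lt_top)] with n hn
    have hm : MemLp (fun x => ξ n x - k x) p (volume.restrict Ω) := ⟨(hξ n).sub hk.1, hn⟩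
    have hm' : MemLp (ξ n) p (volume.restrict Ω) := by
      refine (hm.add hk).ae_eq (ae_of_all _ fun x => ?_)
      simp
    rw [← integral_sub (integrable_inner_of_memLp hm' hg) (integrable_inner_of_memLp hk hg)]
    simp only [← inner_sub_left]
    exact abs_integral_inner_le hm hg
  have hη' : MemLp (fun x => η x • e) q (volume.restrict Ω) :=
    (hη.continuous.smul continuous_const).memLp_of_hasCompactSupport hc.smul_right
  have l1 := hlim hf (fun n => (hζ n).continuous.aestronglyMeasurable) a1
    (memLp_fderiv_of_hasCompactSupport hη hc e)
  have l2 := hlim hG (fun n => (continuous_gradient_of_contDiff (hζ n)).aestronglyMeasurable) a2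
    hη'
  have e1 : ∀ k : Plane → ℝ, ∫ x in Ω, (inner ℝ (k x) (fderiv ℝ η x e) : ℝ) =
      ∫ x in Ω, k x * fderiv ℝ η x e := fun k => by
    simp only [RCLike.inner_apply, conj_trivial, mul_comm]
  have e2 : ∀ k : Plane → Plane, ∫ x in Ω, (inner ℝ (k x) (η x • e) : ℝ) =
      ∫ x in Ω, inner ℝ (k x) e * η x := fun k => by
    simp only [real_inner_smul_right, mul_comm]
  simp only [e1] at l1
  simp only [e2] at l2
  refine tendsto_nhds_unique l1 (l2.neg.congr fun n => ?_)
  exact (setIntegral_mul_fderiv_of_contDiff (hζ n) hη hc hs e).symm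

lemma IsSobolev.sub [ENNReal.HolderConjugate p q] {f₁ f₂ : Plane → ℝ} {G₁ G₂ : Plane → Plane}
    (h₁ : IsSobolev Ω p f₁ G₁) (h₂ : IsSobolev Ω p f₂ G₂) :
    IsSobolev Ω p (fun x => f₁ x - f₂ x) (fun x => G₁ x - G₂ x) := by
  refine ⟨h₁.memLp.sub h₂.memLp, h₁.memLp_grad.sub h₂.memLp_grad, fun η hη hc hs e => ?_⟩
  have i : ∀ {f : Plane → ℝ}, MemLp f p (volume.restrict Ω) →
      Integrable (fun x => f x * fderiv ℝ η x e) (volume.restrict Ω) := fun hf =>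
    hf.integrable_mul (q := q) (memLp_fderiv_of_hasCompactSupport hη hc e)
  have j : ∀ {G : Plane → Plane}, MemLp G p (volume.restrict Ω) →
      Integrable (fun x => inner ℝ (G x) e * η x) (volume.restrict Ω) := fun hG =>
    (hG.inner_const e).integrable_mul (q := q) (memLp_of_contDiff_hasCompactSupport hη hc)
  simp only [sub_mul, inner_sub_left]
  rw [integral_sub (i h₁.memLp) (i h₂.memLp), integral_sub (j h₁.memLp_grad) (j h₂.memLp_grad),
    h₁.weak_grad η hη hc hs e, h₂.weak_grad η hη hc hs e]
  ring

end Sobolev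

/-! ### Energy estimates for differences of weak solutions -/

instance (T : ℝ) : IsFiniteMeasure (timeMeasure T) := by
  unfold timeMeasure; infer_instance

/-- K is controlled only on [0, ∞), so K(max ξ 0), antitone on all of ℝ, supplies measurability. -/
lemma measurable_smul_of_antitoneOn {K : ℝ → ℝ} (hK : AntitoneOn K (Ici 0)) :
    Measurable fun x : Plane => K ‖x‖ • x := by
  have h1 : Antitone fun ξ => K (max ξ 0) := fun ξ η h =>
    hK (mem_Ici.2 (le_max_right _ _)) (mem_Ici.2 (le_max_right _ _)) (max_le_max_right 0 h)
  have h2 : (fun x : Plane => K ‖x‖) = (fun ξ => K (max ξ 0)) ∘ fun x => ‖x‖ := by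
    ext x; simp
  have h3 : Measurable fun x : Plane => K ‖x‖ := h2 ▸ h1.measurable.comp measurable_norm
  exact h3.smul measurable_id

/-- Divide K(ξ)ξ² ≤ d₂ξ^{2−a} by ξ > 0; at ξ = 0 the exponent 1 − a > 0 makes both sides vanish. -/
lemma K1Structure.norm_smul_le {K : ℝ → ℝ} {a a₀ : ℝ} (hK : K1Structure K a a₀) (ha1 : a < 1) :
    ∃ d : ℝ, 0 < d ∧ ∀ x : Plane, ‖K ‖x‖ • x‖ ≤ d * ‖x‖ ^ (1 - a) := by
  obtain ⟨d₁, d₂, d₃, -, hd₂, -, h⟩ := hK.bounds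
  refine ⟨d₂, hd₂, fun x => ?_⟩
  rcases (norm_nonneg x).eq_or_lt with h0 | h0
  · rw [norm_smul, ← h0, mul_zero, Real.zero_rpow (by linarith), mul_zero]
  · have h1 := (h ‖x‖ h0.le).2.2.2
    rw [norm_smul, Real.norm_of_nonneg (hK.pos _ h0.le).le]
    rw [show (2 - a : ℝ) = 1 - a + 1 by ring, Real.rpow_add_one h0.ne', sq] at h1
    refine le_of_mul_le_mul_right ?_ h0
    linarith

/-- The flux of an `L^{2-a}` gradient lies in the dual space. -/
lemma K1Structure.memLp_flux {X : Type*} {mX : MeasurableSpace X} {ν : Measure X} {K : ℝ → ℝ}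
    {a a₀ : ℝ} (hK : K1Structure K a a₀) (ha1 : a < 1) {G : X → Plane}
    (hG : MemLp G (ENNReal.ofReal (2 - a)) ν) :
    MemLp (fun x => K ‖G x‖ • G x) (ENNReal.ofReal ((2 - a) / (1 - a))) ν := by
  obtain ⟨d, hd, h⟩ := hK.norm_smul_le ha1
  have h1 := (hG.norm_rpow_div (ENNReal.ofReal (1 - a))).const_mul d
  rw [ENNReal.toReal_ofReal (by linarith), ← ENNReal.ofReal_div_of_pos (by linarith)] at h1
  refine h1.mono ((measurable_smul_of_antitoneOn hK.antitone).comp_aemeasurable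
    hG.1.aemeasurable).aestronglyMeasurable (ae_of_all _ fun x => (h (G x)).trans ?_)
  exact le_abs_self _

/-- Linear growth suffices: b(0) may be nonzero, but constants are in L^p of a finite measure. -/
lemma memLp_comp_of_lipschitzWith {X : Type*} {mX : MeasurableSpace X} {ν : Measure X}
    [IsFiniteMeasure ν] {b : ℝ → ℝ} {L : NNReal} (hb : LipschitzWith L b) {p : ℝ≥0∞} {f : X → ℝ}
    (hf : MemLp f p ν) : MemLp (fun x => b (f x)) p ν := by
  refine ((hf.norm.const_mul (L : ℝ)).add (memLp_const |b 0|)).mono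
    (hb.continuous.comp_aestronglyMeasurable hf.1) (ae_of_all _ fun x => ?_)
  have h1 := hb.dist_le_mul (f x) 0
  rw [dist_zero_right, Real.dist_eq] at h1
  have h2 : |b (f x)| ≤ |b (f x) - b 0| + |b 0| := by
    simpa using abs_add_le (b (f x) - b 0) (b 0)
  simp only [Pi.add_apply, Real.norm_eq_abs] at *
  exact (h2.trans (by linarith)).trans (le_abs_self _)

lemma integral_inner_neg_sub {X H : Type*} {mX : MeasurableSpace X} [NormedAddCommGroup H]
    [InnerProductSpace ℝ H] {ν : Measure X} {f₁ f₂ g : X → H}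
    (h₁ : Integrable (fun x => (inner ℝ (f₁ x) (g x) : ℝ)) ν)
    (h₂ : Integrable (fun x => (inner ℝ (f₂ x) (g x) : ℝ)) ν) :
    ∫ x, (inner ℝ (-(f₁ x - f₂ x)) (g x) : ℝ) ∂ν =
      -(∫ x, (inner ℝ (f₁ x) (g x) : ℝ) ∂ν) + ∫ x, (inner ℝ (f₂ x) (g x) : ℝ) ∂ν := by
  simp only [neg_sub, inner_sub_left]
  rw [integral_sub h₂ h₁]
  ring

lemma integral_inner_sub_left {X H : Type*} {mX : MeasurableSpace X} [NormedAddCommGroup H]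
    [InnerProductSpace ℝ H] {ν : Measure X} {f₁ f₂ g : X → H}
    (h₁ : Integrable (fun x => (inner ℝ (f₁ x) (g x) : ℝ)) ν)
    (h₂ : Integrable (fun x => (inner ℝ (f₂ x) (g x) : ℝ)) ν) :
    ∫ x, (inner ℝ (f₁ x - f₂ x) (g x) : ℝ) ∂ν =
      (∫ x, (inner ℝ (f₁ x) (g x) : ℝ) ∂ν) - ∫ x, (inner ℝ (f₂ x) (g x) : ℝ) ∂ν := by
  simp only [inner_sub_left]
  exact integral_sub h₁ h₂

/-- Functions with the same initial value: the difference is the integral of the difference of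
the derivatives. -/
lemma HasTimeDerivative.sub_ae {T : ℝ} {m₁ m₂ f₁ f₂ m f : ℝ → ℝ} {m₀ : ℝ}
    (h₁ : HasTimeDerivative T m₁ m₀ f₁) (h₂ : HasTimeDerivative T m₂ m₀ f₂)
    (hm : ∀ᵐ t ∂(timeMeasure T), m t = m₁ t - m₂ t)
    (hf : ∀ᵐ t ∂(timeMeasure T), f t = f₁ t - f₂ t) :
    ∀ᵐ t ∂(timeMeasure T), m t = ∫ s in (0 : ℝ)..t, f s := by
  rw [timeMeasure, ae_restrict_iff' measurableSet_Ioo] at hf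
  filter_upwards [h₁.2, h₂.2, hm, ae_restrict_mem measurableSet_Ioo] with t e1 e2 e3 ht
  have hi : ∀ {k : ℝ → ℝ}, IntegrableOn k (Ioo 0 T) → IntervalIntegrable k volume 0 t := by
    intro k hk
    rw [intervalIntegrable_iff_integrableOn_Ioc_of_le ht.1.le]
    exact hk.mono_set fun s hs => ⟨hs.1, hs.2.trans_lt ht.2⟩
  have : ∫ s in (0 : ℝ)..t, f s = ∫ s in (0 : ℝ)..t, (f₁ s - f₂ s) := by
    refine intervalIntegral.integral_congr_ae ?_
    filter_upwards [hf] with s hs hm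
    rw [uIoc_of_le ht.1.le] at hm
    exact hs ⟨hm.1, hm.2.trans_lt ht.2⟩
  rw [this, intervalIntegral.integral_sub (hi h₁.1) (hi h₂.1), e3, e1, e2]
  ring

lemma intervalIntegral_mono_ae_timeMeasure {T t : ℝ} (ht : t ∈ Ioo 0 T) {f g : ℝ → ℝ}
    (hf : Integrable f (timeMeasure T)) (hg : Integrable g (timeMeasure T))
    (h : ∀ᵐ s ∂(timeMeasure T), f s ≤ g s) :
    ∫ s in (0 : ℝ)..t, f s ≤ ∫ s in (0 : ℝ)..t, g s := by
  have hsub : Ioo 0 t ⊆ Ioo 0 T := Ioo_subset_Ioo_right ht.2.le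
  rw [intervalIntegral.integral_of_le ht.1.le, intervalIntegral.integral_of_le ht.1.le,
    integral_Ioc_eq_integral_Ioo, integral_Ioc_eq_integral_Ioo]
  exact integral_mono_ae (IntegrableOn.mono_set hf hsub) (IntegrableOn.mono_set hg hsub)
    (ae_restrict_of_ae_restrict_of_subset hsub h)

section Difference

variable {T : ℝ} {Ω ΓR : Set Plane} {a a₀ K₂ : ℝ} {K b : ℝ → ℝ} {L : NNReal}
  {φ u₀ v₀ : Plane → ℝ} {u₁ v₁ u₂ v₂ : ℝ → Plane → ℝ}

lemma abs_sub_coupling_le (hb : LipschitzWith L b) (r₁ s₁ r₂ s₂ : ℝ) :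
    |b (r₁ - s₁) - b (r₂ - s₂)| ≤ L * (|r₁ - r₂| + |s₁ - s₂|) := by
  have h1 := hb.dist_le_mul (r₁ - s₁) (r₂ - s₂)
  rw [Real.dist_eq, Real.dist_eq] at h1
  refine h1.trans (mul_le_mul_of_nonneg_left ?_ L.2)
  rw [show r₁ - s₁ - (r₂ - s₂) = (r₁ - r₂) - (s₁ - s₂) by ring]
  exact abs_sub _ _

/-- The energy estimate for the difference of the second components. -/
lemma IsWeakSolution.energy_snd [IsFiniteMeasure (volume.restrict Ω)] (hb : LipschitzWith L b)
    (hK₂ : 0 < K₂)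
    (h₁ : IsWeakSolution T Ω ΓR 2 a K K₂ b φ u₀ v₀ u₁ v₁)
    (h₂ : IsWeakSolution T Ω ΓR 2 a K K₂ b φ u₀ v₀ u₂ v₂) :
    ∀ᵐ t ∂(timeMeasure T), ∫ x in Ω, (v₁ t x - v₂ t x) ^ 2 / 2 ≤
      ∫ s in (0 : ℝ)..t, L * ∫ x in Ω,
        (|u₁ s x - u₂ s x| + |v₁ s x - v₂ s x|) * |v₁ s x - v₂ s x| := by
  obtain ⟨mu₁, -, Gv₁, -, -, sv₁, -, -, eq₁⟩ := h₁
  obtain ⟨mu₂, -, Gv₂, -, -, sv₂, -, -, eq₂⟩ := h₂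
  rw [ENNReal.ofReal_ofNat] at mu₁ mu₂
  have mv₁ := sv₁.memLp
  have mv₂ := sv₂.memLp
  have mG₁ := sv₁.memLp_grad
  have mG₂ := sv₂.memLp_grad
  unfold cylMeasure at mu₁ mu₂ mv₁ mv₂ mG₁ mG₂
  have mb₁ : MemLp (fun z : ℝ × Plane => b (u₁ z.1 z.2 - v₁ z.1 z.2)) 2
    ((timeMeasure T).prod (volume.restrict Ω)) := memLp_comp_of_lipschitzWith hb (mu₁.sub mv₁)
  have mb₂ : MemLp (fun z : ℝ × Plane => b (u₂ z.1 z.2 - v₂ z.1 z.2)) 2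
    ((timeMeasure T).prod (volume.restrict Ω)) := memLp_comp_of_lipschitzWith hb (mu₂.sub mv₂)
  have mw : MemLp (fun z : ℝ × Plane => u₁ z.1 z.2 - u₂ z.1 z.2) 2
    ((timeMeasure T).prod (volume.restrict Ω)) := mu₁.sub mu₂
  have mz : MemLp (fun z : ℝ × Plane => v₁ z.1 z.2 - v₂ z.1 z.2) 2
    ((timeMeasure T).prod (volume.restrict Ω)) := mv₁.sub mv₂
  have mGz : MemLp (fun z : ℝ × Plane => Gv₁ z.1 z.2 - Gv₂ z.1 z.2) 2
    ((timeMeasure T).prod (volume.restrict Ω)) := mG₁.sub mG₂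
  let F₁ : ℝ → Plane → ℝ := fun t x => b (u₁ t x - v₁ t x) - b (u₂ t x - v₂ t x)
  let F₂ : ℝ → Plane → Plane := fun t x => -(K₂ • Gv₁ t x - K₂ • Gv₂ t x)
  have mF₁ : MemLp (fun z : ℝ × Plane => F₁ z.1 z.2) 2
    ((timeMeasure T).prod (volume.restrict Ω)) := mb₁.sub mb₂
  have mF₂ : MemLp (fun z : ℝ × Plane => F₂ z.1 z.2) 2
    ((timeMeasure T).prod (volume.restrict Ω)) := ((mG₁.const_smul K₂).sub (mG₂.const_smul K₂)).neg
  have two0 : (2 : ℝ≥0∞) ≠ 0 := by norm_num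
  have twot : (2 : ℝ≥0∞) ≠ ⊤ := by norm_num
  -- With κ = 0 the boundary slot disappears, and ε = 0 makes θ the identity: everything here is in
  -- L², so no truncation is needed.
  have key := integral_truncPrim_le (T := T) (μ := volume.restrict Ω) (κ := 0) (p := 2) (q := 2)
    (w := fun t x => v₁ t x - v₂ t x) (F₁ := F₁) (F₂ := F₂) (F₃ := 0) (B₃ := 0)
    (B₂ := fun t x => Gv₁ t x - Gv₂ t x)
    (Test := fun ψ G h => IsSobolev Ω 2 ψ G) twot twot mz mF₁ mF₂ MemLp.zero ?_ le_rfl mGz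
    MemLp.zero ?_
  · filter_upwards [key, ae_restrict_mem measurableSet_Ioo] with t ht hm
    simp only [truncPrim_zero_left, trunc_zero_left] at ht
    refine ht.trans (intervalIntegral_mono_ae_timeMeasure hm ?_ ?_ ?_)
    · have i1 := (integrable_inner_of_memLp mF₁ mz).integral_prod_left
      have i2 := (integrable_inner_of_memLp mF₂ mGz).integral_prod_left
      refine (i1.add i2).congr (ae_of_all _ fun s => ?_)
      simp [triplePairing]
    · exact (((mw.norm.add mz.norm).integrable_mul mz.norm).integral_prod_left).const_mul (L : ℝ)
    · filter_upwards [memLp_slice (B := fun t x => u₁ t x - u₂ t x) two0 twot mw,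
        memLp_slice (B := fun t x => v₁ t x - v₂ t x) two0 twot mz,
        memLp_slice two0 twot mF₁] with s hw hz hF
      have n2 : ∫ x in Ω, (inner ℝ (F₂ s x) (Gv₁ s x - Gv₂ s x) : ℝ) ≤ 0 := by
        refine integral_nonpos fun x => ?_
        simp only [F₂, ← smul_sub, inner_neg_left, real_inner_smul_left, real_inner_self_eq_norm_sq,
          Pi.zero_apply]
        have := mul_nonneg hK₂.le (sq_nonneg ‖Gv₁ s x - Gv₂ s x‖)
        linarith
      have n1 : ∫ x in Ω, (inner ℝ (F₁ s x) (v₁ s x - v₂ s x) : ℝ) ≤ L * ∫ x in Ω,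
          (|u₁ s x - u₂ s x| + |v₁ s x - v₂ s x|) * |v₁ s x - v₂ s x| := by
        rw [← integral_const_mul]
        refine integral_mono (integrable_inner_of_memLp (p := 2) hF hz)
          (((hw.norm.add hz.norm).integrable_mul hz.norm).const_mul (L : ℝ)) fun x => ?_
        refine (real_inner_le_norm _ _).trans ?_
        rw [← mul_assoc]
        exact mul_le_mul_of_nonneg_right (abs_sub_coupling_le hb _ _ _ _) (abs_nonneg _)
      simp only [triplePairing, integral_zero_measure, add_zero]
      linarith
  · intro ψ G h hψ mψ mG _
    refine (eq₁ ψ G hψ).sub_ae (eq₂ ψ G hψ) ?_ ?_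
    · filter_upwards [memLp_slice two0 twot mv₁, memLp_slice two0 twot mv₂] with t h1 h2
      rw [integral_inner_sub_left (integrable_inner_of_memLp (p := 2) h1 mψ)
        (integrable_inner_of_memLp (p := 2) h2 mψ)]
      simp only [RCLike.inner_apply, conj_trivial, mul_comm]
    · filter_upwards [memLp_slice (B := fun t x => b (u₁ t x - v₁ t x)) two0 twot mb₁,
        memLp_slice (B := fun t x => b (u₂ t x - v₂ t x)) two0 twot mb₂,
        memLp_slice two0 twot mG₁, memLp_slice two0 twot mG₂] with t h1 h2 h3 h4
      have h3' : MemLp (fun x => K₂ • Gv₁ t x) 2 (volume.restrict Ω) := h3.const_smul K₂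
      have h4' : MemLp (fun x => K₂ • Gv₂ t x) 2 (volume.restrict Ω) := h4.const_smul K₂
      simp only [triplePairing, integral_zero_measure, add_zero, F₁, F₂]
      rw [integral_inner_sub_left (integrable_inner_of_memLp (p := 2) h1 mψ)
        (integrable_inner_of_memLp (p := 2) h2 mψ),
        integral_inner_neg_sub (integrable_inner_of_memLp (p := 2) h3' mG)
        (integrable_inner_of_memLp (p := 2) h4' mG)]
      simp only [RCLike.inner_apply, conj_trivial, mul_comm, real_inner_smul_left]
      ring
  · filter_upwards [sv₁.sobolev, sv₂.sobolev] with t h1 h2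
    simpa only [trunc_zero_left] using h1.sub (q := 2) h2

/-- The energy estimate for the difference of the first components, for the truncated energy. -/
lemma IsWeakSolution.truncPrim_energy_fst [IsFiniteMeasure (volume.restrict Ω)]
    [IsFiniteMeasure (arcLength (frontier Ω))] (hΓ : ΓR ⊆ frontier Ω)
    (hK : K1Structure K a a₀) (hKm : MonotoneOn (fun ξ => K ξ * ξ) (Ici 0)) (ha1 : a < 1)
    (hb : LipschitzWith L b)
    (hφ : MemLp φ ⊤ (arcLength ΓR)) (hφ0 : ∀ᵐ x ∂(arcLength ΓR), 0 ≤ φ x)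
    (h₁ : IsWeakSolution T Ω ΓR 2 a K K₂ b φ u₀ v₀ u₁ v₁)
    (h₂ : IsWeakSolution T Ω ΓR 2 a K K₂ b φ u₀ v₀ u₂ v₂) {ε : ℝ} (hε : 0 < ε) :
    ∀ᵐ t ∂(timeMeasure T), ∫ x in Ω, truncPrim ε (u₁ t x - u₂ t x) ≤
      ∫ s in (0 : ℝ)..t, L * ∫ x in Ω,
        (|u₁ s x - u₂ s x| + |v₁ s x - v₂ s x|) * |u₁ s x - u₂ s x| := by
  have hle : arcLength ΓR ≤ arcLength (frontier Ω) := Measure.restrict_mono hΓ le_rfl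
  have hfinR : IsFiniteMeasure (arcLength ΓR) := isFiniteMeasure_of_le _ hle
  set p := ENNReal.ofReal (2 - a) with hp
  set q := ENNReal.ofReal ((2 - a) / (1 - a)) with hq
  have hconj : Real.HolderConjugate (2 - a) ((2 - a) / (1 - a)) := by
    rw [Real.holderConjugate_iff_eq_conjExponent (by linarith)]
    congr 1
    ring
  have hpq : ENNReal.HolderConjugate p q := hconj.ennrealOfReal
  have hqp : ENNReal.HolderConjugate q p := ENNReal.HolderConjugate.symm
  have hp1 : 1 ≤ p := ENNReal.one_le_ofReal.2 (by linarith)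
  have hq1 : 1 ≤ q := ENNReal.one_le_ofReal.2 hconj.symm.lt.le
  have hpt : p ≠ ⊤ := ENNReal.ofReal_ne_top
  have hqt : q ≠ ⊤ := ENNReal.ofReal_ne_top
  have hp0 : p ≠ 0 := (one_pos.trans_le hp1).ne'
  have hq0 : q ≠ 0 := (one_pos.trans_le hq1).ne'
  have : Fact (1 ≤ p) := ⟨hp1⟩
  have : Fact (1 ≤ q) := ⟨hq1⟩
  have two0 : (2 : ℝ≥0∞) ≠ 0 := by norm_num
  have twot : (2 : ℝ≥0∞) ≠ ⊤ := by norm_num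
  obtain ⟨mu₁, Gu₁, Gv₁, τ₁, su₁, sv₁, tr₁, eq₁, -⟩ := h₁
  obtain ⟨mu₂, Gu₂, Gv₂, τ₂, su₂, sv₂, tr₂, eq₂, -⟩ := h₂
  rw [ENNReal.ofReal_ofNat] at mu₁ mu₂
  simp only [ENNReal.ofReal_ofNat] at eq₁ eq₂
  have mv₁ := sv₁.memLp
  have mv₂ := sv₂.memLp
  have mG₁ := su₁.memLp_grad
  have mG₂ := su₂.memLp_grad
  have hprod : (timeMeasure T).prod (arcLength ΓR) ≤
      (timeMeasure T).prod (arcLength (frontier Ω)) := Measure.prod_mono le_rfl hle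
  have mτ₁ := tr₁.memLp.mono_measure hprod
  have mτ₂ := tr₂.memLp.mono_measure hprod
  unfold cylMeasure at mu₁ mu₂ mv₁ mv₂ mG₁ mG₂
  have mb₁ : MemLp (fun z : ℝ × Plane => b (u₁ z.1 z.2 - v₁ z.1 z.2)) 2
    ((timeMeasure T).prod (volume.restrict Ω)) := memLp_comp_of_lipschitzWith hb (mu₁.sub mv₁)
  have mb₂ : MemLp (fun z : ℝ × Plane => b (u₂ z.1 z.2 - v₂ z.1 z.2)) 2
    ((timeMeasure T).prod (volume.restrict Ω)) := memLp_comp_of_lipschitzWith hb (mu₂.sub mv₂)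
  have mw : MemLp (fun z : ℝ × Plane => u₁ z.1 z.2 - u₂ z.1 z.2) 2
    ((timeMeasure T).prod (volume.restrict Ω)) := mu₁.sub mu₂
  have mz : MemLp (fun z : ℝ × Plane => v₁ z.1 z.2 - v₂ z.1 z.2) 2
    ((timeMeasure T).prod (volume.restrict Ω)) := mv₁.sub mv₂
  have mGw : MemLp (fun z : ℝ × Plane => Gu₁ z.1 z.2 - Gu₂ z.1 z.2) p
    ((timeMeasure T).prod (volume.restrict Ω)) := mG₁.sub mG₂
  have mV₁ : MemLp (fun z : ℝ × Plane => K ‖Gu₁ z.1 z.2‖ • Gu₁ z.1 z.2) q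
    ((timeMeasure T).prod (volume.restrict Ω)) := hK.memLp_flux ha1 mG₁
  have mV₂ : MemLp (fun z : ℝ × Plane => K ‖Gu₂ z.1 z.2‖ • Gu₂ z.1 z.2) q
    ((timeMeasure T).prod (volume.restrict Ω)) := hK.memLp_flux ha1 mG₂
  have mτ : MemLp (fun z : ℝ × Plane => τ₁ z.1 z.2 - τ₂ z.1 z.2) p
    ((timeMeasure T).prod (arcLength ΓR)) := mτ₁.sub mτ₂
  have mφ : MemLp (fun z : ℝ × Plane => φ z.2) ⊤ ((timeMeasure T).prod (arcLength ΓR)) :=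
    hφ.comp_snd _
  have mφτ₁ : MemLp (fun z : ℝ × Plane => φ z.2 * τ₁ z.1 z.2) p
    ((timeMeasure T).prod (arcLength ΓR)) := mτ₁.mul mφ
  have mφτ₂ : MemLp (fun z : ℝ × Plane => φ z.2 * τ₂ z.1 z.2) p
    ((timeMeasure T).prod (arcLength ΓR)) := mτ₂.mul mφ
  let F₁ : ℝ → Plane → ℝ := fun t x => -(b (u₁ t x - v₁ t x) - b (u₂ t x - v₂ t x))
  let F₂ : ℝ → Plane → Plane := fun t x =>
    -(K ‖Gu₁ t x‖ • Gu₁ t x - K ‖Gu₂ t x‖ • Gu₂ t x)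
  let F₃ : ℝ → Plane → ℝ := fun t x => -(φ x * τ₁ t x - φ x * τ₂ t x)
  have mF₁ : MemLp (fun z : ℝ × Plane => F₁ z.1 z.2) 2
    ((timeMeasure T).prod (volume.restrict Ω)) := (mb₁.sub mb₂).neg
  have mF₂ : MemLp (fun z : ℝ × Plane => F₂ z.1 z.2) q
    ((timeMeasure T).prod (volume.restrict Ω)) := (mV₁.sub mV₂).neg
  have mF₃ : MemLp (fun z : ℝ × Plane => F₃ z.1 z.2) p
    ((timeMeasure T).prod (arcLength ΓR)) := (mφτ₁.sub mφτ₂).neg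
  let B₂ : ℝ → Plane → Plane := fun t x =>
    deriv (trunc ε) (u₁ t x - u₂ t x) • (Gu₁ t x - Gu₂ t x)
  let B₃ : ℝ → Plane → ℝ := fun t x => trunc ε (τ₁ t x - τ₂ t x)
  have mB₁ : MemLp (fun z : ℝ × Plane => trunc ε (u₁ z.1 z.2 - u₂ z.1 z.2)) 2
    ((timeMeasure T).prod (volume.restrict Ω)) := memLp_trunc mw hε.le
  have mB₂ : MemLp (fun z : ℝ × Plane => B₂ z.1 z.2) p
    ((timeMeasure T).prod (volume.restrict Ω)) := memLp_deriv_trunc_smul mw.1 mGw hε.le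
  -- The reason for truncating: the difference of traces is only in L^{2−a}, but its truncation is
  -- bounded and the boundary measure finite.
  have mB₃ : MemLp (fun z : ℝ × Plane => B₃ z.1 z.2) q
    ((timeMeasure T).prod (arcLength ΓR)) :=
    MemLp.of_bound (memLp_trunc mτ hε.le).1 (1 / √ε)
      (ae_of_all _ fun z => abs_trunc_le_const hε _)
  have key := integral_truncPrim_le (T := T) (μ := volume.restrict Ω) (κ := arcLength ΓR)
    (w := fun t x => u₁ t x - u₂ t x) (F₁ := F₁) (F₂ := F₂) (F₃ := F₃) (B₂ := B₂) (B₃ := B₃)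
    (Test := fun ψ G h => IsSobolev Ω p ψ G ∧ IsTrace Ω p ψ G h) hpt hqt mw mF₁ mF₂ mF₃
    ?_ hε.le mB₂ mB₃ ?_
  · filter_upwards [key, ae_restrict_mem measurableSet_Ioo] with t ht hm
    refine ht.trans (intervalIntegral_mono_ae_timeMeasure hm ?_ ?_ ?_)
    · have i1 := (integrable_inner_of_memLp mF₁ mB₁).integral_prod_left
      have i2 := (integrable_inner_of_memLp mF₂ mB₂).integral_prod_left
      have i3 := (integrable_inner_of_memLp mF₃ mB₃).integral_prod_left
      exact (i1.add i2).add i3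
    · exact (((mw.norm.add mz.norm).integrable_mul mw.norm).integral_prod_left).const_mul (L : ℝ)
    · filter_upwards [memLp_slice (B := fun t x => u₁ t x - u₂ t x) two0 twot mw,
        memLp_slice (B := fun t x => v₁ t x - v₂ t x) two0 twot mz,
        memLp_slice two0 twot mF₁,
        memLp_slice (B := fun t x => trunc ε (u₁ t x - u₂ t x)) two0 twot mB₁] with s hw hz hF hB
      have n1 : ∫ x in Ω, (inner ℝ (F₁ s x) (trunc ε (u₁ s x - u₂ s x)) : ℝ) ≤ L * ∫ x in Ω,
          (|u₁ s x - u₂ s x| + |v₁ s x - v₂ s x|) * |u₁ s x - u₂ s x| := by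
        rw [← integral_const_mul]
        refine integral_mono (integrable_inner_of_memLp (p := 2) hF hB)
          (((hw.norm.add hz.norm).integrable_mul hw.norm).const_mul (L : ℝ)) fun x => ?_
        refine (real_inner_le_norm _ _).trans ?_
        simp only [F₁, norm_neg]
        rw [← mul_assoc]
        exact mul_le_mul (abs_sub_coupling_le hb _ _ _ _) (abs_trunc_le hε.le _) (norm_nonneg _)
          (by positivity)
      -- The integrand is −θ'(w) ≤ 0 times the monotonicity product of the fluxes.
      have n2 : ∫ x in Ω, (inner ℝ (F₂ s x) (B₂ s x) : ℝ) ≤ 0 := by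
        refine integral_nonpos fun x => ?_
        simp only [F₂, B₂, inner_neg_left, real_inner_smul_right, Pi.zero_apply]
        have := mul_nonneg (deriv_trunc_nonneg hε.le (u₁ s x - u₂ s x))
          (inner_sub_nonneg_of_monotoneOn (fun ξ hξ => (hK.pos ξ hξ).le) hKm (Gu₁ s x) (Gu₂ s x))
        linarith
      -- With r the difference of the traces, the integrand is −φ r θ(r), and r θ(r) ≥ 0.
      have n3 : ∫ x, (inner ℝ (F₃ s x) (B₃ s x) : ℝ) ∂(arcLength ΓR) ≤ 0 := by
        refine integral_nonpos_of_ae ?_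
        filter_upwards [hφ0] with x hx
        simp only [F₃, B₃, RCLike.inner_apply, conj_trivial, Pi.zero_apply]
        have := mul_nonneg hx (trunc_mul_self_nonneg (ε := ε) (τ₁ s x - τ₂ s x))
        linarith
      simp only [triplePairing]
      linarith
  · rintro ψ G h ⟨hψ, hh⟩ mψ mG mh
    obtain ⟨ib₁, d₁⟩ := eq₁ ψ G h mψ hψ hh
    obtain ⟨ib₂, d₂⟩ := eq₂ ψ G h mψ hψ hh
    refine d₁.sub_ae d₂ ?_ ?_
    · filter_upwards [memLp_slice two0 twot mu₁, memLp_slice two0 twot mu₂] with t h1 h2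
      rw [integral_inner_sub_left (integrable_inner_of_memLp (p := 2) h1 mψ)
        (integrable_inner_of_memLp (p := 2) h2 mψ)]
      simp only [RCLike.inner_apply, conj_trivial, mul_comm]
    · filter_upwards [memLp_slice (B := fun t x => b (u₁ t x - v₁ t x)) two0 twot mb₁,
        memLp_slice (B := fun t x => b (u₂ t x - v₂ t x)) two0 twot mb₂,

        memLp_slice (B := fun t x => K ‖Gu₁ t x‖ • Gu₁ t x) hq0 hqt mV₁,
        memLp_slice (B := fun t x => K ‖Gu₂ t x‖ • Gu₂ t x) hq0 hqt mV₂,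
        memLp_slice (B := fun t x => φ x * τ₁ t x) hp0 hpt mφτ₁,

        memLp_slice (B := fun t x => φ x * τ₂ t x) hp0 hpt mφτ₂] with t h1 h2 h3 h4 h5 h6
      simp only [triplePairing, F₁, F₂, F₃]
      rw [integral_inner_neg_sub (integrable_inner_of_memLp (p := 2) h1 mψ)
        (integrable_inner_of_memLp (p := 2) h2 mψ),
        integral_inner_neg_sub (integrable_inner_of_memLp h3 mG)
        (integrable_inner_of_memLp h4 mG),
        integral_inner_neg_sub (integrable_inner_of_memLp h5 mh)
        (integrable_inner_of_memLp h6 mh)]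
      have c1 : ∀ (f : Plane → ℝ) (g : Plane → ℝ) (ν : Measure Plane),
          ∫ x, (inner ℝ (f x) (g x) : ℝ) ∂ν = ∫ x, f x * g x ∂ν := fun f g ν => by
        simp only [RCLike.inner_apply, conj_trivial, mul_comm]
      simp only [c1, real_inner_smul_left]
      ring
  · filter_upwards [su₁.sobolev, su₂.sobolev, tr₁.trace, tr₂.trace] with t s1 s2 t1 t2
    have ht := t1.sub hp1 s1.memLp s2.memLp s1.memLp_grad s2.memLp_grad t2
    have hs := s1.sub (q := q) s2
    have htr := ht.trunc_comp hp1 hpt hs.memLp hs.memLp_grad hε.le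
    exact ⟨htr.isSobolev (q := q) (memLp_trunc hs.memLp hε.le)
      (memLp_deriv_trunc_smul hs.memLp.1 hs.memLp_grad hε.le), htr⟩

/-- The energy estimate for the difference of the first components. -/
lemma IsWeakSolution.energy_fst [IsFiniteMeasure (volume.restrict Ω)]
    [IsFiniteMeasure (arcLength (frontier Ω))] (hΓ : ΓR ⊆ frontier Ω)
    (hK : K1Structure K a a₀) (hKm : MonotoneOn (fun ξ => K ξ * ξ) (Ici 0)) (ha1 : a < 1)
    (hb : LipschitzWith L b)
    (hφ : MemLp φ ⊤ (arcLength ΓR)) (hφ0 : ∀ᵐ x ∂(arcLength ΓR), 0 ≤ φ x)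
    (h₁ : IsWeakSolution T Ω ΓR 2 a K K₂ b φ u₀ v₀ u₁ v₁)
    (h₂ : IsWeakSolution T Ω ΓR 2 a K K₂ b φ u₀ v₀ u₂ v₂) :
    ∀ᵐ t ∂(timeMeasure T), ∫ x in Ω, (u₁ t x - u₂ t x) ^ 2 / 2 ≤
      ∫ s in (0 : ℝ)..t, L * ∫ x in Ω,
        (|u₁ s x - u₂ s x| + |v₁ s x - v₂ s x|) * |u₁ s x - u₂ s x| := by
  have hall : ∀ᵐ t ∂(timeMeasure T), ∀ n : ℕ,
      ∫ x in Ω, truncPrim (1 / ((n : ℝ) + 1)) (u₁ t x - u₂ t x) ≤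
      ∫ s in (0 : ℝ)..t, L * ∫ x in Ω,
        (|u₁ s x - u₂ s x| + |v₁ s x - v₂ s x|) * |u₁ s x - u₂ s x| :=
    ae_all_iff.2 fun n => truncPrim_energy_fst hΓ hK hKm ha1 hb hφ hφ0 h₁ h₂
      Nat.one_div_pos_of_nat
  have mw : MemLp (fun z : ℝ × Plane => u₁ z.1 z.2 - u₂ z.1 z.2) 2
      ((timeMeasure T).prod (volume.restrict Ω)) := by
    have mu₁ := h₁.1
    have mu₂ := h₂.1
    rw [ENNReal.ofReal_ofNat] at mu₁ mu₂
    exact mu₁.sub mu₂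
  filter_upwards [hall,
        memLp_slice (B := fun t x => u₁ t x - u₂ t x) two_ne_zero ENNReal.ofNat_ne_top mw] with t ht hw
  -- Dominated convergence with majorant w²/2 removes the truncation. The right side does not depend
  -- on ε, and only countably many ε are used, so the null sets can be united.
  have hlim : Tendsto (fun n : ℕ => ∫ x in Ω, truncPrim (1 / ((n : ℝ) + 1)) (u₁ t x - u₂ t x))
      atTop (𝓝 (∫ x in Ω, (u₁ t x - u₂ t x) ^ 2 / 2)) := by
    have hpos : ∀ n : ℕ, (0 : ℝ) ≤ 1 / ((n : ℝ) + 1) := fun n => by positivity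
    refine tendsto_integral_of_dominated_convergence (fun x => (u₁ t x - u₂ t x) ^ 2 / 2)
      (fun n => (integrable_truncPrim hw (hpos n)).1) (hw.integrable_sq.div_const 2)
      (fun n => ae_of_all _ fun x => ?_) (ae_of_all _ fun x => ?_)
    · rw [Real.norm_of_nonneg (truncPrim_nonneg _)]
      exact truncPrim_le (hpos n) _
    · exact (tendsto_truncPrim _).comp tendsto_one_div_add_atTop_nhds_zero_nat
  exact le_of_tendsto' hlim ht

/-- Uniqueness of weak solutions for a monotone flux. -/
theorem IsWeakSolution.unique [IsFiniteMeasure (volume.restrict Ω)]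
    [IsFiniteMeasure (arcLength (frontier Ω))] (hΓ : ΓR ⊆ frontier Ω)
    (hK : K1Structure K a a₀) (hKm : MonotoneOn (fun ξ => K ξ * ξ) (Ici 0)) (ha1 : a < 1)
    (hK₂ : 0 < K₂) (hb : LipschitzWith L b)
    (hφ : MemLp φ ⊤ (arcLength ΓR)) (hφ0 : ∀ᵐ x ∂(arcLength ΓR), 0 ≤ φ x)
    (h₁ : IsWeakSolution T Ω ΓR 2 a K K₂ b φ u₀ v₀ u₁ v₁)
    (h₂ : IsWeakSolution T Ω ΓR 2 a K K₂ b φ u₀ v₀ u₂ v₂) :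
    (∀ᵐ z ∂(cylMeasure T Ω), u₁ z.1 z.2 = u₂ z.1 z.2) ∧
    (∀ᵐ z ∂(cylMeasure T Ω), v₁ z.1 z.2 = v₂ z.1 z.2) := by
  have e₁ := energy_fst hΓ hK hKm ha1 hb hφ hφ0 h₁ h₂
  have e₂ := energy_snd hb hK₂ h₁ h₂
  have mw : MemLp (fun z : ℝ × Plane => u₁ z.1 z.2 - u₂ z.1 z.2) 2
      ((timeMeasure T).prod (volume.restrict Ω)) := by
    have mu₁ := h₁.1
    have mu₂ := h₂.1
    rw [ENNReal.ofReal_ofNat] at mu₁ mu₂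
    exact mu₁.sub mu₂
  have mz : MemLp (fun z : ℝ × Plane => v₁ z.1 z.2 - v₂ z.1 z.2) 2
      ((timeMeasure T).prod (volume.restrict Ω)) := by
    obtain ⟨-, -, Gv₁, -, -, sv₁, -⟩ := h₁
    obtain ⟨-, -, Gv₂, -, -, sv₂, -⟩ := h₂
    exact sv₁.memLp.sub sv₂.memLp
  have iw := mw.integrable_sq
  have iz := mz.integrable_sq
  set y : ℝ → ℝ := fun t => (∫ x in Ω, (u₁ t x - u₂ t x) ^ 2 / 2) +
    ∫ x in Ω, (v₁ t x - v₂ t x) ^ 2 / 2 with hy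
  have hyi : Integrable y (timeMeasure T) :=
    ((iw.div_const 2).integral_prod_left).add ((iz.div_const 2).integral_prod_left)
  have nonneg : ∀ f : Plane → ℝ, 0 ≤ ∫ x in Ω, f x ^ 2 / 2 := fun f =>
    integral_nonneg fun x => by positivity
  have iA : Integrable (fun t => L * ∫ x in Ω, (|u₁ t x - u₂ t x| + |v₁ t x - v₂ t x|) *
      |u₁ t x - u₂ t x|) (timeMeasure T) :=
    (((mw.norm.add mz.norm).integrable_mul mw.norm).integral_prod_left).const_mul (L : ℝ)
  have iB : Integrable (fun t => L * ∫ x in Ω, (|u₁ t x - u₂ t x| + |v₁ t x - v₂ t x|) *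
      |v₁ t x - v₂ t x|) (timeMeasure T) :=
    (((mw.norm.add mz.norm).integrable_mul mz.norm).integral_prod_left).const_mul (L : ℝ)
  -- The two coupling bounds add up to L∫(|w| + |z|)² ≤ 2L∫(w² + z²), and the energy carries a
  -- factor ½; hence 4L.
  have hgron : ∀ᵐ t ∂(timeMeasure T), y t ≤ (4 * L) * ∫ s in (0 : ℝ)..t, y s := by
    filter_upwards [e₁, e₂, ae_restrict_mem measurableSet_Ioo] with t h1 h2 ht
    have hi : ∀ {k : ℝ → ℝ}, Integrable k (timeMeasure T) → IntervalIntegrable k volume 0 t := by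
      intro k hk
      rw [intervalIntegrable_iff_integrableOn_Ioc_of_le ht.1.le]
      exact IntegrableOn.mono_set hk fun s hs => ⟨hs.1, hs.2.trans_lt ht.2⟩
    refine (add_le_add h1 h2).trans ?_
    rw [← intervalIntegral.integral_add (hi iA) (hi iB), ← intervalIntegral.integral_const_mul]
    refine intervalIntegral_mono_ae_timeMeasure ht (iA.add iB) (hyi.const_mul _) ?_
    filter_upwards [memLp_slice (B := fun t x => u₁ t x - u₂ t x) two_ne_zero ENNReal.ofNat_ne_top mw,

        memLp_slice (B := fun t x => v₁ t x - v₂ t x) two_ne_zero ENNReal.ofNat_ne_top mz] with s hw hz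
    have jA := (hw.norm.add hz.norm).integrable_mul hw.norm
    have jB := (hw.norm.add hz.norm).integrable_mul hz.norm
    have jw := hw.integrable_sq.div_const 2
    have jz := hz.integrable_sq.div_const 2
    have hle : (∫ x in Ω, (|u₁ s x - u₂ s x| + |v₁ s x - v₂ s x|) * |u₁ s x - u₂ s x|) +
        ∫ x in Ω, (|u₁ s x - u₂ s x| + |v₁ s x - v₂ s x|) * |v₁ s x - v₂ s x| ≤ 4 * y s := by
      rw [hy]
      simp only
      rw [← integral_add jw jz, ← integral_const_mul]
      refine (integral_add jA jB).symm.trans_le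
        (integral_mono (jA.add jB) ((jw.add jz).const_mul 4) fun x => ?_)
      simp only [Pi.add_apply, Pi.mul_apply, Real.norm_eq_abs]
      rw [← sq_abs (u₁ s x - u₂ s x), ← sq_abs (v₁ s x - v₂ s x)]
      nlinarith [sq_nonneg (|u₁ s x - u₂ s x| - |v₁ s x - v₂ s x|)]
    rw [← mul_add]
    calc _ ≤ (L : ℝ) * (4 * y s) := mul_le_mul_of_nonneg_left hle L.2
      _ = _ := by ring
  have hzero := ae_eq_zero_of_le_mul_integral (T := T) (C := 4 * L) (by positivity) hyi
    (ae_of_all _ fun t => add_nonneg (nonneg _) (nonneg _)) hgron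
  -- Fubini converts vanishing energy at almost every time into vanishing almost everywhere on the
  -- cylinder.
  have hconc : ∀ {f : ℝ × Plane → ℝ},
      Integrable (fun z => f z ^ 2) ((timeMeasure T).prod (volume.restrict Ω)) →
      (∀ᵐ t ∂(timeMeasure T), ∫ x in Ω, f (t, x) ^ 2 / 2 = 0) →
      ∀ᵐ z ∂(cylMeasure T Ω), f z = 0 := by
    intro f hf h0
    have h1 : ∫ z, f z ^ 2 / 2 ∂((timeMeasure T).prod (volume.restrict Ω)) = 0 := by
      rw [integral_prod _ (hf.div_const 2)]
      exact integral_eq_zero_of_ae h0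
    have h2 := (integral_eq_zero_iff_of_nonneg (fun z => by positivity) (hf.div_const 2)).1 h1
    filter_upwards [h2] with z hz
    simpa using hz
  constructor
  · have := hconc iw (hzero.mono fun t ht => by
      have n1 := nonneg fun x => u₁ t x - u₂ t x
      have n2 := nonneg fun x => v₁ t x - v₂ t x
      simp only [hy] at ht
      linarith)
    exact this.mono fun z hz => sub_eq_zero.1 hz
  · have := hconc iz (hzero.mono fun t ht => by
      have n1 := nonneg fun x => u₁ t x - u₂ t x
      have n2 := nonneg fun x => v₁ t x - v₂ t x
      simp only [hy] at ht
      linarith)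
    exact this.mono fun z hz => sub_eq_zero.1 hz

end Difference

end ForchheimerUniqueness

end

/-! ### Uniqueness for the generalized Forchheimer flux -/

theorem theorem3p5
    -- the domain, the time horizon
    (Ω ΓN ΓR : Set ForchheimerUniqueness.Plane)
    (hΩ : ForchheimerUniqueness.IsC1Domain Ω ΓN ΓR)
    (T : ℝ) (hT : 0 < T)
    -- the generalized polynomial `g` and the exponent `a`
    (N : ℕ) (coef expo : Fin (N + 1) → ℝ)
    (hcoef : ∀ k, 0 ≤ coef k) (hcoef0 : 0 < coef 0) (hexpo : ∀ k, 0 ≤ expo k)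
    (hg0 : 0 < ForchheimerUniqueness.genPoly coef expo 0)
    (a : ℝ) (ha : a = expo (Fin.last N) / (expo (Fin.last N) + 1)) (ha0 : 0 < a) (ha1 : a < 1)
    -- the parameters, for `λ = 1`, `δ = 0`
    (α σ : ℝ) (hα1 : 2 ≤ α) (hα2 : α ≤ 2) (hσ0 : 0 < σ) (hσ1 : σ < 1) (hσα : σ ≤ α / 2)
    -- the structure of `K₁`
    (hK : ForchheimerUniqueness.K1Structure
      (ForchheimerUniqueness.darcyK1 (ForchheimerUniqueness.genPoly coef expo)) a (coef 0))
    (K₂ : ℝ) (hK₂ : 0 < K₂)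
    -- the coupling
    (b : ℝ → ℝ) (hb_growth : ∃ c : ℝ, 0 < c ∧ ∀ z : ℝ, b z ≤ c * |z| ^ σ)
    (hb_lip : ∃ L : NNReal, LipschitzWith L b)
    -- the boundary coefficient
    (φ : ForchheimerUniqueness.Plane → ℝ)
    (hφ : MemLp φ ⊤ (ForchheimerUniqueness.arcLength ΓR))
    (hφ0 : ∀ᵐ x ∂(ForchheimerUniqueness.arcLength ΓR), 0 ≤ φ x)
    -- the initial data
    (u₀ v₀ : ForchheimerUniqueness.Plane → ℝ)
    (hu₀ : MemLp u₀ (ENNReal.ofReal α) (volume.restrict Ω))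
    (hv₀ : MemLp v₀ 2 (volume.restrict Ω))
    -- two weak solutions with the same data
    (u₁ v₁ u₂ v₂ : ℝ → ForchheimerUniqueness.Plane → ℝ)
    (h₁ : ForchheimerUniqueness.IsWeakSolution T Ω ΓR α a
      (ForchheimerUniqueness.darcyK1 (ForchheimerUniqueness.genPoly coef expo))
      K₂ b φ u₀ v₀ u₁ v₁)
    (h₂ : ForchheimerUniqueness.IsWeakSolution T Ω ΓR α a
      (ForchheimerUniqueness.darcyK1 (ForchheimerUniqueness.genPoly coef expo))
      K₂ b φ u₀ v₀ u₂ v₂) :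
    (∀ᵐ q ∂(ForchheimerUniqueness.cylMeasure T Ω), u₁ q.1 q.2 = u₂ q.1 q.2) ∧
    (∀ᵐ q ∂(ForchheimerUniqueness.cylMeasure T Ω), v₁ q.1 q.2 = v₂ q.1 q.2) := by
  obtain rfl : α = 2 := le_antisymm hα2 hα1
  obtain ⟨L, hb⟩ := hb_lip
  have hfin : IsFiniteMeasure (volume.restrict Ω) :=
    ⟨by simpa using hΩ.isBounded.measure_lt_top⟩
  -- The C¹ regularity of the boundary enters only through its finite length.
  have hlen := ForchheimerUniqueness.hausdorffMeasure_frontier_lt_top hΩ.isOpen hΩ.isBounded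
    hΩ.c1Boundary
  have hfin' : IsFiniteMeasure (ForchheimerUniqueness.arcLength (frontier Ω)) :=
    ⟨by simpa [ForchheimerUniqueness.arcLength] using hlen⟩
  have hΓ : ΓR ⊆ frontier Ω := hΩ.union_eq ▸ subset_union_right
  exact ForchheimerUniqueness.IsWeakSolution.unique hΓ hK
    (ForchheimerUniqueness.monotoneOn_darcyK1_mul
      (ForchheimerUniqueness.monotoneOn_genPoly hcoef hexpo)
      (ForchheimerUniqueness.continuous_genPoly hexpo) hg0)
    ha1 hK₂ hb hφ hφ0 h₁ h₂
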